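/- For integers $N,j\ge 0$ let $$A(N,j)=\sum_{\ell_0+\dots+\ell_j=N}\ \sum_{m_0+\dots+m_j=N}\ \prod_{r=0}^{j}\binom{\ell_r+m_r}{\ell_r}^2 ,$$ the sums being over tuples of non-negative integers, and let $\alpha(w,z)=\sum_{j,N\ge 0}w^jz^NA(N,j)$. For $x,w>0$ with $4x+w^2<1$ put $$\mathcal Q_1(x;\xi)=(\xi-x(\xi^2+1))^2-4x^2\xi^2,\qquad \mathcal Q_2(x,w;\xi)=\mathcal Q_1(x;\xi)-w^2\xi^2,$$ $$c_1,d_2=\frac{1+2x\mp\sqrt{1+4x}}{2x},\qquad c_2,d_1=\frac{1-2x\mp\sqrt{1-4x}}{2x},$$ and, with $s=\sqrt{4x^2+w^2}$, $$a_1,b_2=\frac{1+s\mp\sqrt{1+w^2+2s}}{2x},\qquad a_2,b_1=\frac{1-s\mp\sqrt{1+w^2-2s}}{2x},$$ where in each pair the first name goes with the sign $-$. With principal square roots let $$g(x;\xi)=x\sqrt{\xi-c_1}\,\sqrt{\xi-c_2}\,\sqrt{d_1-\xi}\,\sqrt{d_2-\xi}\qquad\text{on }\mathbb C\setminus\big((-\infty,c_2]\cup[d_1,\infty)\big),$$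 and let $\widetilde g(x;\cdot)$ be its extension to $\mathbb C\setminus([c_1,c_2]\cup[d_1,d_2])$, defined at $\xi\in(-\infty,c_1)\cup(d_2,\infty)$ as the limit of $g(x;\zeta)$ for $\zeta\to\xi$, $\zeta\in\mathbb C\setminus\mathbb R$. For $r\in[c_1,c_2]$ let $\widetilde g_\pm(x;r)=\lim_{\epsilon\to0^+}\widetilde g(x;r\pm i\epsilon)$. Then $0<a_1<c_1<c_2<a_2<1$, the function $\widetilde g(x;\cdot)$ is analytic on $\mathbb C\setminus([c_1,c_2]\cup[d_1,d_2])$, the limits $\widetilde g_\pm(x;r)$ exist for all $r\in[c_1,c_2]$, the double series for $\alpha(w,x^2)$ converges absolutely, and $$\alpha(w,x^2)=\mathcal A_1(x,w)+\mathcal A_2(x,w),$$ where $$\mathcal A_1(x,w)=\frac{w a_1+\widetilde g(x;a_1)}{x^2(a_1-a_2)(a_1-b_1)(a_1-b_2)}+\frac{w a_2+\widetilde g(x;a_2)}{x^2(a_2-a_1)(a_2-b_1)(a_2-b_2)}$$ and $$\mathcal A_2(x,w)=\frac1\pi\int_{c_1}^{c_2}\mathcal I_2(x,w;r)\,dr,\qquad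 \mathcal I_2(x,w;r)=\frac{i\,\widetilde g_+(x;r)-i\,\widetilde g_-(x;r)}{2\,\mathcal Q_2(x,w;r)},$$ the integrand $\mathcal I_2(x,w;\cdot)$ being integrable on $[c_1,c_2]$. For $k=1,2$, the $k$-th summand of $\mathcal A_1(x,w)$ is the residue $\lim_{\xi\to a_k}(\xi-a_k)\,\dfrac{w\xi+\widetilde g(x;\xi)}{\mathcal Q_2(x,w;\xi)}$ at $a_k$. Moreover, with the principal square root, $$\alpha(w,x^2)=\frac1{2\pi i}\oint_{|\xi|=1}\frac{1}{\sqrt{(1-x\xi-x/\xi)^2-4x^2}-w}\,\frac{d\xi}{\xi}.$$ -/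

import Mathlib

open Filter Topology

noncomputable section

namespace UlamMoment

/-- The combinatorial number `A(N, j)`: the sum over all pairs of `(j+1)`-tuples `(ℓ₀,…,ℓ_j)` and
`(m₀,…,m_j)` of non-negative integers, each with total `N`, of `∏ r, ((ℓ_r + m_r).choose ℓ_r)²`. -/
def A (N j : ℕ) : ℕ :=
  ∑ l ∈ Finset.Nat.antidiagonalTuple (j + 1) N, ∑ m ∈ Finset.Nat.antidiagonalTuple (j + 1) N,
    ∏ r : Fin (j + 1), ((l r + m r).choose (l r)) ^ 2

/-- The term of index `p = (j, N)` of the double series `α(w, z)`. -/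
def alphaTerm (w z : ℝ) (p : ℕ × ℕ) : ℝ := w ^ p.1 * z ^ p.2 * (A p.2 p.1 : ℝ)

/-- The generating function `α(w, z) = ∑_{j, N ≥ 0} w ^ j z ^ N A(N, j)`. -/
def alpha (w z : ℝ) : ℝ := ∑' p : ℕ × ℕ, alphaTerm w z p

/-- The quartic `Q₁(x; ξ)`. -/
def Q1 (x : ℝ) (ξ : ℂ) : ℂ := (ξ - x * (ξ ^ 2 + 1)) ^ 2 - 4 * x ^ 2 * ξ ^ 2

/-- The quartic `Q₂(x, w; ξ)`. -/
def Q2 (x w : ℝ) (ξ : ℂ) : ℂ := Q1 x ξ - w ^ 2 * ξ ^ 2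

/-! The four real roots `c₁ < c₂ < d₁ < d₂` of `Q₁(x; ·)`. -/

def c1 (x : ℝ) : ℝ := (1 + 2 * x - √(1 + 4 * x)) / (2 * x)
def c2 (x : ℝ) : ℝ := (1 - 2 * x - √(1 - 4 * x)) / (2 * x)
def d1 (x : ℝ) : ℝ := (1 - 2 * x + √(1 - 4 * x)) / (2 * x)
def d2 (x : ℝ) : ℝ := (1 + 2 * x + √(1 + 4 * x)) / (2 * x)

/-! The four real roots `a₁ < a₂ < b₁ < b₂` of `Q₂(x, w; ·)`. -/

def a1 (x w : ℝ) : ℝ :=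
  (1 + √(4 * x ^ 2 + w ^ 2) - √(1 + w ^ 2 + 2 * √(4 * x ^ 2 + w ^ 2))) / (2 * x)
def a2 (x w : ℝ) : ℝ :=
  (1 - √(4 * x ^ 2 + w ^ 2) - √(1 + w ^ 2 - 2 * √(4 * x ^ 2 + w ^ 2))) / (2 * x)
def b1 (x w : ℝ) : ℝ :=
  (1 - √(4 * x ^ 2 + w ^ 2) + √(1 + w ^ 2 - 2 * √(4 * x ^ 2 + w ^ 2))) / (2 * x)
def b2 (x w : ℝ) : ℝ :=
  (1 + √(4 * x ^ 2 + w ^ 2) + √(1 + w ^ 2 + 2 * √(4 * x ^ 2 + w ^ 2))) / (2 * x)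

/-- The plane cut along `(-∞, c₂(x)]` and `[d₁(x), ∞)`. -/
def D3 (x : ℝ) : Set ℂ := (Complex.ofReal '' (Set.Iic (c2 x) ∪ Set.Ici (d1 x)))ᶜ

/-- The plane cut along `[c₁(x), c₂(x)]` and `[d₁(x), d₂(x)]`. -/
def D4 (x : ℝ) : Set ℂ := (Complex.ofReal '' (Set.Icc (c1 x) (c2 x) ∪ Set.Icc (d1 x) (d2 x)))ᶜ

/-- A square root of `Q₁(x; ·)` on `D3 x`, through principal square roots of the linear factors. -/
def g (x : ℝ) (ξ : ℂ) : ℂ :=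
  x * Complex.sqrt (ξ - c1 x) * Complex.sqrt (ξ - c2 x) *
    Complex.sqrt (d1 x - ξ) * Complex.sqrt (d2 x - ξ)

open Classical in
/-- The continuation of `g x` to `D4 x`: it is `g x` on `D3 x`, and at the remaining points of
`D4 x`, which are the reals in `(-∞, c₁(x)) ∪ (d₂(x), ∞)`, it is the limit of `g x` along the
non-real numbers. Values outside `D4 x` have no meaning and are not used. -/
def gTilde (x : ℝ) (ξ : ℂ) : ℂ :=
  if ξ ∈ D3 x then g x ξ else limUnder (𝓝[{ζ : ℂ | ζ.im ≠ 0}] ξ) (g x)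

/-- The boundary value of `gTilde x` at the real point `r`, from the upper half-plane. -/
def gPlus (x r : ℝ) : ℂ :=
  limUnder (𝓝[>] (0 : ℝ)) (fun ε : ℝ => gTilde x ((r : ℂ) + Complex.I * ε))

/-- The boundary value of `gTilde x` at the real point `r`, from the lower half-plane. -/
def gMinus (x r : ℝ) : ℂ :=
  limUnder (𝓝[>] (0 : ℝ)) (fun ε : ℝ => gTilde x ((r : ℂ) - Complex.I * ε))

/-- The meromorphic integrand `(w ξ + g̃(x; ξ)) / Q₂(x, w; ξ)`. -/
def integrand (x w : ℝ) (ξ : ℂ) : ℂ := (w * ξ + gTilde x ξ) / Q2 x w ξ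

/-- The residue term at `a₁`. -/
def res1 (x w : ℝ) : ℂ :=
  (w * a1 x w + gTilde x (a1 x w)) /
    (x ^ 2 * ((a1 x w - a2 x w) * (a1 x w - b1 x w) * (a1 x w - b2 x w)))

/-- The residue term at `a₂`. -/
def res2 (x w : ℝ) : ℂ :=
  (w * a2 x w + gTilde x (a2 x w)) /
    (x ^ 2 * ((a2 x w - a1 x w) * (a2 x w - b1 x w) * (a2 x w - b2 x w)))

/-- `𝒜₁(x, w)`. -/
def calA1 (x w : ℝ) : ℂ := res1 x w + res2 x w

/-- The jump integrand `I₂(x, w; r)`. -/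
def I2 (x w r : ℝ) : ℂ :=
  (Complex.I * gPlus x r - Complex.I * gMinus x r) / (2 * Q2 x w r)

/-- `𝒜₂(x, w)`. -/
def calA2 (x w : ℝ) : ℂ := 1 / (Real.pi : ℂ) * ∫ r in (c1 x)..(c2 x), I2 x w r

end UlamMoment

end

open UlamMoment

/-!
The theorem has a combinatorial half and a complex-analytic half, which meet in the integral over
the unit circle.

The series. Put `F(u, v) = ∑ ((l + m).choose l)² u^l v^m`. On the torus `u = x exp (θ i)`,
`v = x exp (-θ i)` the homogeneous part of degree `n` is the mean over `φ` of
`(2x cos θ + 2x cos φ)ⁿ` (`integral_cos_add_cos_pow`). A geometric series and the Poisson integral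
then give `F = 1 / S(θ)` with `S(θ) = √((1 - 2x cos θ)² - 4x²)` (`hasSum_circleTerm`). The
coefficient of `u^L v^M` in `F^(j+1)` is a sum over pairs of tuples with totals `L` and `M`, so
`∑ w^j F^(j+1) = 1 / (S(θ) - w)`, with absolute convergence because `w < √(1 - 4x) ≤ S(θ)`.
Integration over `θ` keeps the terms with `L = M`, which form the series for `α`
(`hasSum_alphaTerm`). This is the circle integral of the last claim.

The contour. On the unit circle `gTilde x ξ = ξ S(θ)` (`gTilde_eq_mul_radial`), so the integrand of
the circle integral is `(w ξ + gTilde x ξ) / Q₂`. Throughout `D4 x` the function `gTilde x` is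
`-x cutSqrt c₁ c₂ · cutSqrt d₁ d₂`, where `cutSqrt a b` is the square root of `(ξ - a)(ξ - b)` cut
along `[a, b]` only. The contour is shrunk to `[c₁, c₂]` without deforming it: the Stieltjes
representation
`cutSqrt a b ξ = ξ - (a + b)/2 - π⁻¹ ∫ √((r - a)(b - r)) / (ξ - r) dr` over `r ∈ [a, b]`
(`integral_semicircle_div_sub`, proved in the Joukowski coordinate) turns the circle integral into
a superposition of integrals with one additional simple pole `r`, to which partial fractions and
Cauchy's formula apply. The contributions of the poles `a₁`, `a₂` recombine, by the same
representation, to the residues, and those of the poles `r` form the integral over the cut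
(`circleIntegral_cutSqrt`).
-/

open UlamMoment

/-! ### Integrals over the circle -/

/-- Orthogonality of the characters of the circle. -/
theorem integral_exp_int_mul_I (k : ℤ) :
    ∫ θ in (0 : ℝ)..(2 * Real.pi), Complex.exp (k * θ * Complex.I) =
      if k = 0 then (2 * Real.pi : ℂ) else 0 := by
  split_ifs with hk
  · simp [hk]
  · have hc : (k : ℂ) * Complex.I ≠ 0 := by simp [hk]
    have := integral_exp_mul_complex (a := 0) (b := 2 * Real.pi) hc
    have h1 : (fun θ : ℝ => Complex.exp (k * θ * Complex.I)) =
        fun θ : ℝ => Complex.exp (k * Complex.I * θ) := by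
      ext θ; congr 1; ring
    rw [h1, this]
    have h2 : Complex.exp (k * Complex.I * ((2 * Real.pi : ℝ) : ℂ)) = 1 := by
      rw [Complex.exp_eq_one_iff]
      exact ⟨k, by push_cast; ring⟩
    rw [h2]; simp

theorem one_sub_two_mul_cos_add_sq (q : ℂ) (θ : ℝ) :
    1 - 2 * q * Real.cos θ + q ^ 2 =
      (1 - q * Complex.exp (θ * Complex.I)) * (1 - q * Complex.exp (-(θ * Complex.I))) := by
  have h : Complex.exp (θ * Complex.I) * Complex.exp (-(θ * Complex.I)) = 1 := by
    rw [← Complex.exp_add]; simp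
  rw [Complex.ofReal_cos, Complex.cos, neg_mul]
  linear_combination (-q ^ 2) * h

theorem one_sub_mul_ne_zero {q z : ℂ} (hq : ‖q‖ < 1) (hz : ‖z‖ ≤ 1) : 1 - q * z ≠ 0 := by
  intro h
  have h1 : q * z = 1 := (sub_eq_zero.1 h).symm
  have h2 : ‖q‖ * ‖z‖ = 1 := by rw [← norm_mul, h1, norm_one]
  nlinarith [norm_nonneg q, norm_nonneg z]

theorem one_sub_two_mul_cos_add_sq_ne_zero {q : ℂ} (hq : ‖q‖ < 1) (θ : ℝ) :
    1 - 2 * q * Real.cos θ + q ^ 2 ≠ 0 := by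
  rw [one_sub_two_mul_cos_add_sq]
  refine mul_ne_zero (one_sub_mul_ne_zero hq ?_) (one_sub_mul_ne_zero hq ?_)
  · rw [Complex.norm_exp_ofReal_mul_I]
  · rw [← neg_mul, ← Complex.ofReal_neg, Complex.norm_exp_ofReal_mul_I]

theorem continuous_inv_poisson {q : ℂ} (hq : ‖q‖ < 1) :
    Continuous fun θ : ℝ => (1 - 2 * q * Real.cos θ + q ^ 2)⁻¹ := by
  refine Continuous.inv₀ ?_ (one_sub_two_mul_cos_add_sq_ne_zero hq)
  fun_prop

/-- The Poisson integral with a complex parameter `q`, by Cauchy's formula for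
`z ↦ (1 - q z)⁻¹` at the point `q`. -/
theorem integral_inv_poisson {q : ℂ} (hq : ‖q‖ < 1) :
    ∫ θ in (0 : ℝ)..(2 * Real.pi), (1 - 2 * q * Real.cos θ + q ^ 2)⁻¹ =
      (2 * Real.pi : ℂ) / (1 - q ^ 2) := by
  have hd : DifferentiableOn ℂ (fun z => (1 - q * z)⁻¹) (Metric.closedBall 0 1) := by
    intro z hz
    have : 1 - q * z ≠ 0 := one_sub_mul_ne_zero hq (by simpa using hz)
    have h1 : DifferentiableAt ℂ (fun z : ℂ => 1 - q * z) z := by fun_prop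
    exact (h1.inv this).differentiableWithinAt
  have h := hd.circleIntegral_sub_inv_smul (w := q) (by simpa using hq)
  rw [circleIntegral] at h
  have h1 : ∀ θ : ℝ, deriv (circleMap 0 1) θ •
      ((circleMap 0 1 θ - q)⁻¹ • (1 - q * circleMap 0 1 θ)⁻¹) =
      Complex.I * (1 - 2 * q * Real.cos θ + q ^ 2)⁻¹ := by
    intro θ
    rw [one_sub_two_mul_cos_add_sq]
    have hz : ‖Complex.exp (θ * Complex.I)‖ = 1 := Complex.norm_exp_ofReal_mul_I θ
    have h2 : 1 - q * Complex.exp (θ * Complex.I) ≠ 0 := one_sub_mul_ne_zero hq hz.le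
    have h3 : 1 - q * Complex.exp (-(θ * Complex.I)) ≠ 0 := one_sub_mul_ne_zero hq (by
      rw [← neg_mul, ← Complex.ofReal_neg, Complex.norm_exp_ofReal_mul_I])
    have h4 : Complex.exp (θ * Complex.I) * Complex.exp (-(θ * Complex.I)) = 1 := by
      rw [← Complex.exp_add]; simp
    have h5 : Complex.exp (θ * Complex.I) - q =
        Complex.exp (θ * Complex.I) * (1 - q * Complex.exp (-(θ * Complex.I))) := by
      linear_combination q * h4
    simp only [deriv_circleMap, circleMap, zero_add, Complex.ofReal_one, one_mul, smul_eq_mul]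
    rw [h5]
    have h6 := Complex.exp_ne_zero (θ * Complex.I)
    field_simp
  rw [intervalIntegral.integral_congr (fun θ _ => h1 θ), intervalIntegral.integral_const_mul,
    smul_eq_mul] at h
  have := Complex.I_ne_zero
  apply mul_left_cancel₀ this
  rw [h, ← sq]
  ring

/-- Half of `integral_inv_poisson`, by the symmetry `θ ↦ 2π - θ`. -/
theorem integral_inv_poisson_zero_pi {q : ℂ} (hq : ‖q‖ < 1) :
    ∫ θ in (0 : ℝ)..Real.pi, (1 - 2 * q * Real.cos θ + q ^ 2)⁻¹ =
      (Real.pi : ℂ) / (1 - q ^ 2) := by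
  have hc := continuous_inv_poisson hq
  have h := integral_inv_poisson hq
  rw [← intervalIntegral.integral_add_adjacent_intervals (b := Real.pi)
    (hc.intervalIntegrable _ _) (hc.intervalIntegrable _ _)] at h
  have h2 : ∫ θ in Real.pi..(2 * Real.pi), (1 - 2 * q * Real.cos θ + q ^ 2)⁻¹ =
      ∫ θ in (0 : ℝ)..Real.pi, (1 - 2 * q * Real.cos θ + q ^ 2)⁻¹ := by
    have := intervalIntegral.integral_comp_sub_left
      (fun θ : ℝ => (1 - 2 * q * Real.cos θ + q ^ 2)⁻¹) (a := 0) (b := Real.pi) (2 * Real.pi)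
    simp only [Real.cos_two_pi_sub] at this
    rw [this]
    congr 1 <;> ring
  rw [h2] at h
  linear_combination h / 2

/-- Division of `sin²` by the Poisson denominator leaves a multiple of the Poisson kernel and a
trigonometric polynomial. -/
theorem integral_sin_sq_div_poisson {q : ℂ} (hq : ‖q‖ < 1) (hq0 : q ≠ 0) :
    ∫ θ in (0 : ℝ)..Real.pi, (Real.sin θ : ℂ) ^ 2 / (1 - 2 * q * Real.cos θ + q ^ 2) =
      (Real.pi : ℂ) / 2 := by
  have hc := continuous_inv_poisson hq
  have h1 : ∀ θ : ℝ, (Real.sin θ : ℂ) ^ 2 / (1 - 2 * q * Real.cos θ + q ^ 2) =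
      (-(1 - q ^ 2) ^ 2 / (4 * q ^ 2)) * (1 - 2 * q * Real.cos θ + q ^ 2)⁻¹ +
        ((1 + q ^ 2) / (4 * q ^ 2) + (2 * q)⁻¹ * (Real.cos θ : ℂ)) := by
    intro θ
    have h2 := one_sub_two_mul_cos_add_sq_ne_zero hq θ
    have h3 : (Real.sin θ : ℂ) ^ 2 = 1 - (Real.cos θ : ℂ) ^ 2 := by
      have := Real.sin_sq_add_cos_sq θ
      have h : (Real.sin θ : ℂ) ^ 2 + (Real.cos θ : ℂ) ^ 2 = 1 := by exact_mod_cast this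
      linear_combination h
    rw [h3]
    generalize (Real.cos θ : ℂ) = c at *
    rw [div_eq_iff h2, add_mul, mul_assoc, inv_mul_cancel₀ h2]
    field_simp
    ring
  have hcos : ∫ θ in (0 : ℝ)..Real.pi, (Real.cos θ : ℂ) = 0 := by
    rw [intervalIntegral.integral_ofReal, integral_cos]; simp
  have hne : (1 - q ^ 2 : ℂ) ≠ 0 := by
    have := one_sub_mul_ne_zero hq hq.le
    rwa [← sq] at this
  have hi : IntervalIntegrable (fun θ : ℝ => (2 * q)⁻¹ * (Real.cos θ : ℂ)) MeasureTheory.volume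
      0 Real.pi := Continuous.intervalIntegrable (by fun_prop) _ _
  have hi' : IntervalIntegrable (fun θ : ℝ => (-(1 - q ^ 2) ^ 2 / (4 * q ^ 2)) *
      (1 - 2 * q * Real.cos θ + q ^ 2)⁻¹) MeasureTheory.volume 0 Real.pi :=
    (continuous_const.mul hc).intervalIntegrable _ _
  simp_rw [h1]
  rw [intervalIntegral.integral_add hi' (intervalIntegrable_const.add hi),
    intervalIntegral.integral_add intervalIntegrable_const hi,
    intervalIntegral.integral_const_mul, intervalIntegral.integral_const_mul,
    integral_inv_poisson_zero_pi hq, hcos, intervalIntegral.integral_const]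
  simp only [sub_zero, Complex.real_smul]
  field_simp
  ring

/-! ### The square root of a quadratic, cut along a segment -/

theorem Complex.sqrt_sq_eq (z : ℂ) : Complex.sqrt z ^ 2 = z := by
  simp [Complex.sqrt]

theorem Complex.eq_sqrt_of_sq_eq {y z : ℂ} (h : y ^ 2 = z) (hy : 0 < y.re) :
    Complex.sqrt z = y := by
  have h1 : (Complex.sqrt z - y) * (Complex.sqrt z + y) = 0 := by
    linear_combination Complex.sqrt_sq_eq z - h
  rcases mul_eq_zero.1 h1 with h2 | h2
  · exact sub_eq_zero.1 h2
  · have h3 : 0 ≤ (Complex.sqrt z).re := by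
      rw [Complex.sqrt, Complex.cpow_inv_two_re]; positivity
    have h4 := congrArg Complex.re h2
    simp only [Complex.add_re, Complex.zero_re] at h4
    linarith

theorem Complex.re_sqrt_pos {z : ℂ} (hz : z ∈ Complex.slitPlane) : 0 < (Complex.sqrt z).re := by
  rw [Complex.sqrt, Complex.cpow_inv_two_re]
  refine Real.sqrt_pos.2 (div_pos ?_ two_pos)
  rcases hz with h | h
  · have := norm_nonneg z; linarith
  · have := Complex.abs_re_lt_norm.2 h
    have := neg_abs_le z.re
    linarith

/-- A square root of `(ξ - a) (ξ - b)`, analytic off the segment `[a, b]` and asymptotic to `ξ`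
at infinity. -/
noncomputable def cutSqrt (a b : ℝ) (ξ : ℂ) : ℂ := (ξ - a) * Complex.sqrt ((ξ - b) / (ξ - a))

theorem sub_ofReal_ne_zero {a b r : ℝ} {ξ : ℂ} (hξ : ξ ∉ Complex.ofReal '' Set.Icc a b)
    (hr : r ∈ Set.Icc a b) : ξ - r ≠ 0 :=
  fun h => hξ ⟨r, hr, (sub_eq_zero.1 h).symm⟩

theorem cutSqrt_sq {a b : ℝ} {ξ : ℂ} (h : ξ - a ≠ 0) :
    cutSqrt a b ξ ^ 2 = (ξ - a) * (ξ - b) := by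
  rw [cutSqrt, mul_pow, Complex.sqrt_sq_eq]
  field_simp

/-- The Möbius map `ξ ↦ (ξ - b) / (ξ - a)` sends only the segment into `(-∞, 0] ∪ {∞}`. -/
theorem div_sub_mem_slitPlane {a b : ℝ} (hab : a < b) {ξ : ℂ}
    (hξ : ξ ∉ Complex.ofReal '' Set.Icc a b) : (ξ - b) / (ξ - a) ∈ Complex.slitPlane := by
  have ha : ξ - a ≠ 0 := sub_ofReal_ne_zero hξ ⟨le_rfl, hab.le⟩
  by_contra hn
  rw [Complex.mem_slitPlane_iff, not_or, not_lt, not_not] at hn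
  obtain ⟨h1, h2⟩ := hn
  set t := ((ξ - b) / (ξ - a)).re with ht
  have h3 : (ξ - b) / (ξ - a) = (t : ℂ) := by
    apply Complex.ext <;> simp [ht, h2]
  rw [div_eq_iff ha] at h3
  have h5 : (1 - t : ℂ) ≠ 0 := by
    have : (1 - t : ℝ) ≠ 0 := by linarith
    exact_mod_cast this
  have h4 : ξ = (((b - t * a) / (1 - t) : ℝ) : ℂ) := by
    push_cast
    rw [eq_div_iff h5]
    linear_combination h3
  refine hξ ⟨_, ⟨?_, ?_⟩, h4.symm⟩
  · rw [le_div_iff₀ (by linarith)]; nlinarith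
  · rw [div_le_iff₀ (by linarith)]; nlinarith

theorem differentiableAt_cutSqrt {a b : ℝ} (hab : a < b) {ξ : ℂ}
    (hξ : ξ ∉ Complex.ofReal '' Set.Icc a b) : DifferentiableAt ℂ (cutSqrt a b) ξ := by
  have ha : ξ - a ≠ 0 := sub_ofReal_ne_zero hξ ⟨le_rfl, hab.le⟩
  have h1 : DifferentiableAt ℂ (fun ξ : ℂ => (ξ - b) / (ξ - a)) ξ :=
    DifferentiableAt.div (by fun_prop) (by fun_prop) ha
  have h2 := (Complex.differentiableAt_sqrt (div_sub_mem_slitPlane hab hξ)).comp ξ h1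
  exact DifferentiableAt.mul (by fun_prop) h2

/-- The principal square roots of `p` and `q` lie in the right half-plane; if they are not strictly
separated by the real axis, then their quotient lies there as well. -/
theorem Complex.sqrt_div_of_im {p q : ℂ} (hp : p ∈ Complex.slitPlane) (hq : q ∈ Complex.slitPlane)
    (h : 0 ≤ (Complex.sqrt p).im * (Complex.sqrt q).im) :
    Complex.sqrt (p / q) = Complex.sqrt p / Complex.sqrt q := by
  have hp' := Complex.re_sqrt_pos hp
  have hq' := Complex.re_sqrt_pos hq
  have hq0 : Complex.sqrt q ≠ 0 := fun h => by simp [h] at hq'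
  refine Complex.eq_sqrt_of_sq_eq ?_ ?_
  · rw [div_pow, Complex.sqrt_sq_eq, Complex.sqrt_sq_eq]
  · rw [Complex.div_re, ← add_div]
    have := Complex.normSq_pos.2 hq0
    have := mul_pos hp' hq'
    positivity

theorem Complex.sqrt_im_mul_im_nonneg {p q : ℂ} (h : 0 ≤ p.im ∧ 0 ≤ q.im ∨ p.im < 0 ∧ q.im < 0) :
    0 ≤ (Complex.sqrt p).im * (Complex.sqrt q).im := by
  rcases h with ⟨h1, h2⟩ | ⟨h1, h2⟩
  · rw [Complex.sqrt, Complex.sqrt, Complex.cpow_inv_two_im_eq_sqrt h1,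
      Complex.cpow_inv_two_im_eq_sqrt h2]
    positivity
  · rw [Complex.sqrt, Complex.sqrt, Complex.cpow_inv_two_im_eq_neg_sqrt h1,
      Complex.cpow_inv_two_im_eq_neg_sqrt h2, neg_mul_neg]
    positivity

/-- Every point off the segment `[a, b]` is the image under the Joukowski map of a point outside
the unit circle. -/
theorem exists_joukowski {a b : ℝ} (hab : a < b) {ξ : ℂ}
    (hξ : ξ ∉ Complex.ofReal '' Set.Icc a b) :
    ∃ t : ℂ, 1 < ‖t‖ ∧ ξ = (a + b) / 2 + (b - a) / 4 * (t + t⁻¹) := by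
  have hba : (b - a : ℂ) ≠ 0 := by
    have : b - a ≠ 0 := by linarith
    exact_mod_cast this
  obtain ⟨ζ, hζ⟩ : ∃ ζ : ℂ, ξ = (a + b) / 2 + (b - a) / 2 * ζ :=
    ⟨(ξ - (a + b) / 2) / ((b - a) / 2), by field_simp; ring⟩
  have hy := Complex.sqrt_sq_eq (ζ ^ 2 - 1)
  set y := Complex.sqrt (ζ ^ 2 - 1)
  have h1 : (ζ + y) * (ζ - y) = 1 := by linear_combination -hy
  have key : ∀ t s : ℂ, t * s = 1 → t + s = 2 * ζ → 1 ≤ ‖t‖ →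
      ∃ t : ℂ, 1 < ‖t‖ ∧ ξ = (a + b) / 2 + (b - a) / 4 * (t + t⁻¹) := by
    intro t s hts hsum ht
    have hinv : t⁻¹ = s := inv_eq_of_mul_eq_one_right hts
    refine ⟨t, lt_of_le_of_ne ht fun h => ?_, ?_⟩
    · -- On the unit circle the Joukowski map takes real values in the segment.
      have hconj : s = (starRingEnd ℂ) t := by
        rw [← hinv, Complex.inv_def, Complex.normSq_eq_norm_sq, ← h]; simp
      rw [hconj, Complex.add_conj] at hsum
      have hz : ζ = t.re := by
        push_cast at hsum
        linear_combination -hsum / 2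
      have habs : |t.re| ≤ 1 := by rw [h]; exact Complex.abs_re_le_norm t
      have h2 := abs_le.1 habs
      refine hξ ⟨(a + b) / 2 + (b - a) / 2 * t.re, ⟨?_, ?_⟩, ?_⟩
      · nlinarith
      · nlinarith
      · rw [hζ, hz]; push_cast; ring
    · rw [hinv, hsum, hζ]; ring
  rcases le_total 1 ‖ζ + y‖ with h | h
  · exact key _ _ h1 (by ring) h
  · refine key (ζ - y) (ζ + y) (by rw [mul_comm, h1]) (by ring) ?_
    have h2 : ‖ζ + y‖ * ‖ζ - y‖ = 1 := by rw [← norm_mul, h1, norm_one]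
    nlinarith [norm_nonneg (ζ - y), norm_nonneg (ζ + y)]

/-- In the Joukowski coordinate the cut square root is rational. -/
theorem cutSqrt_joukowski {a b : ℝ} (hab : a < b) {t : ℂ} (ht : 1 < ‖t‖) :
    cutSqrt a b ((a + b) / 2 + (b - a) / 4 * (t + t⁻¹)) = (b - a) / 4 * (t - t⁻¹) := by
  have ht0 : t ≠ 0 := fun h => by norm_num [h] at ht
  have hba : (b - a : ℂ) ≠ 0 := by
    have : b - a ≠ 0 := by linarith
    exact_mod_cast this
  have ht1 : t + 1 ≠ 0 := fun h => by
    rw [eq_neg_of_add_eq_zero_left h] at ht; norm_num at ht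
  have e1 : ((a + b) / 2 + (b - a) / 4 * (t + t⁻¹) - a : ℂ) = (b - a) / 4 * (t + 1) ^ 2 / t := by
    field_simp; ring
  have e2 : ((a + b) / 2 + (b - a) / 4 * (t + t⁻¹) - b : ℂ) = (b - a) / 4 * (t - 1) ^ 2 / t := by
    field_simp; ring
  have hs : Complex.sqrt (((b - a) / 4 * (t - 1) ^ 2 / t) / ((b - a) / 4 * (t + 1) ^ 2 / t)) =
      (t - 1) / (t + 1) := by
    refine Complex.eq_sqrt_of_sq_eq (by field_simp) ?_
    rw [Complex.div_re, ← add_div]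
    refine div_pos ?_ (Complex.normSq_pos.2 ht1)
    have h2 : 1 < t.re * t.re + t.im * t.im := by
      rw [← Complex.normSq_apply, Complex.normSq_eq_norm_sq]; nlinarith
    simp
    nlinarith
  rw [cutSqrt, e1, e2, hs]
  field_simp
  ring

/-- The Stieltjes transform of the semicircle density. In the Joukowski coordinate the substitution
`r = (a + b) / 2 - (b - a) / 2 * cos θ` turns it into `integral_sin_sq_div_poisson`. -/
theorem integral_semicircle_div_sub {a b : ℝ} (hab : a < b) {ξ : ℂ}
    (hξ : ξ ∉ Complex.ofReal '' Set.Icc a b) :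
    ∫ r in a..b, (√((r - a) * (b - r)) : ℂ) / (ξ - r) =
      Real.pi * (ξ - (a + b) / 2 - cutSqrt a b ξ) := by
  obtain ⟨t, ht, rfl⟩ := exists_joukowski hab hξ
  have ht0 : t ≠ 0 := fun h => by norm_num [h] at ht
  have hba : (b - a : ℂ) ≠ 0 := by
    have : b - a ≠ 0 := by linarith
    exact_mod_cast this
  rw [cutSqrt_joukowski hab ht]
  have hq : ‖-t⁻¹‖ < 1 := by rw [norm_neg, norm_inv]; exact inv_lt_one_of_one_lt₀ ht
  have hint := integral_sin_sq_div_poisson hq (by simpa using ht0)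
  set ξ : ℂ := (a + b) / 2 + (b - a) / 4 * (t + t⁻¹) with hξdef
  set G : ℝ → ℂ := fun r => (√((r - a) * (b - r)) : ℂ) / (ξ - r) with hG
  set φ : ℝ → ℝ := fun θ => (a + b) / 2 - (b - a) / 2 * Real.cos θ with hφ
  have hφmem : ∀ θ, φ θ ∈ Set.Icc a b := by
    intro θ
    have h1 := Real.neg_one_le_cos θ
    have h2 := Real.cos_le_one θ
    constructor <;> simp only [hφ] <;> nlinarith
  have hGc : ContinuousOn G (Set.Icc a b) := by
    refine ContinuousOn.div (by fun_prop) (by fun_prop) fun r hr => sub_ofReal_ne_zero hξ hr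
  have hsub := intervalIntegral.integral_deriv_smul_comp''' (a := 0) (b := Real.pi) (f := φ)
    (f' := fun θ => (b - a) / 2 * Real.sin θ) (g := G)
    (by simp only [hφ]; fun_prop)
    (fun θ _ => by
      have := ((Real.hasDerivAt_cos θ).const_mul ((b - a) / 2)).const_sub ((a + b) / 2)
      exact (by simpa [hφ] using this : HasDerivAt φ ((b - a) / 2 * Real.sin θ) θ).hasDerivWithinAt)
    (hGc.mono (by rintro _ ⟨θ, _, rfl⟩; exact hφmem θ))
    ((hGc.mono (by rintro _ ⟨θ, _, rfl⟩; exact hφmem θ)).integrableOn_compact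
      (isCompact_uIcc.image (by simp only [hφ]; fun_prop)))
    (by
      refine ContinuousOn.integrableOn_compact isCompact_uIcc ?_
      have hsc : Continuous fun θ : ℝ => (b - a) / 2 * Real.sin θ := by fun_prop
      refine hsc.continuousOn.smul (hGc.comp (by simp only [hφ]; fun_prop) ?_)
      exact fun θ _ => hφmem θ)
  have e0 : φ 0 = a := by simp only [hφ, Real.cos_zero]; ring
  have e1 : φ Real.pi = b := by simp only [hφ, Real.cos_pi]; ring
  rw [e0, e1] at hsub
  rw [← hsub]
  have hpt : ∀ θ ∈ Set.uIcc 0 Real.pi, ((b - a) / 2 * Real.sin θ) • (G ∘ φ) θ =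
      ((b - a) * t⁻¹) *
        ((Real.sin θ : ℂ) ^ 2 / (1 - 2 * (-t⁻¹) * Real.cos θ + (-t⁻¹) ^ 2)) := by
    intro θ hθ
    rw [Set.uIcc_of_le Real.pi_pos.le] at hθ
    have hsin := Real.sin_nonneg_of_mem_Icc hθ
    have hs : √((φ θ - a) * (b - φ θ)) = (b - a) / 2 * Real.sin θ := by
      have h1 : (φ θ - a) * (b - φ θ) = ((b - a) / 2 * Real.sin θ) ^ 2 := by
        simp only [hφ]
        linear_combination (-((b - a) / 2) ^ 2) * Real.sin_sq_add_cos_sq θ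
      rw [h1, Real.sqrt_sq (mul_nonneg (by linarith) hsin)]
    have hden : ξ - φ θ =
        (b - a) / 4 * t * (1 - 2 * (-t⁻¹) * Real.cos θ + (-t⁻¹) ^ 2) := by
      simp only [hξdef, hφ]; push_cast
      field_simp
      ring
    have hd0 := one_sub_two_mul_cos_add_sq_ne_zero hq θ
    simp only [Function.comp, hG, hs, hden, Complex.real_smul]
    generalize (1 - 2 * (-t⁻¹) * Real.cos θ + (-t⁻¹) ^ 2 : ℂ) = D at *
    push_cast
    field_simp
    ring
  rw [intervalIntegral.integral_congr hpt, intervalIntegral.integral_const_mul, hint, hξdef]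
  field_simp
  ring

/-! ### The roots of the quartics -/

/-- The smaller root of `x r² - t r + x`. The numbers `a₁, c₁, c₂, a₂` are its values at
`t = 1 + √(4x² + w²), 1 + 2x, 1 - 2x, 1 - √(4x² + w²)`. -/
noncomputable def smallRoot (x t : ℝ) : ℝ := (t - √(t ^ 2 - 4 * x ^ 2)) / (2 * x)

theorem smallRoot_pos {x t : ℝ} (hx : 0 < x) (ht : 2 * x < t) : 0 < smallRoot x t := by
  have h : √(t ^ 2 - 4 * x ^ 2) < t := by
    rw [Real.sqrt_lt' (by linarith)]; nlinarith
  exact div_pos (by linarith) (by linarith)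

theorem smallRoot_mul {x t : ℝ} (hx : 0 < x) (ht : 2 * x < t) :
    smallRoot x t * ((t + √(t ^ 2 - 4 * x ^ 2)) / (2 * x)) = 1 := by
  have h := Real.sq_sqrt (show 0 ≤ t ^ 2 - 4 * x ^ 2 by nlinarith)
  rw [smallRoot]
  field_simp
  linear_combination -h

theorem largeRoot_eq {x t : ℝ} (hx : 0 < x) (ht : 2 * x < t) :
    (t + √(t ^ 2 - 4 * x ^ 2)) / (2 * x) = (smallRoot x t)⁻¹ :=
  eq_inv_of_mul_eq_one_right (smallRoot_mul hx ht)

theorem smallRoot_add_inv {x t : ℝ} (hx : 0 < x) (ht : 2 * x < t) :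
    x * (smallRoot x t + (smallRoot x t)⁻¹) = t := by
  rw [← largeRoot_eq hx ht, smallRoot]
  field_simp
  ring

theorem smallRoot_lt_one {x t : ℝ} (hx : 0 < x) (ht : 2 * x < t) : smallRoot x t < 1 := by
  have h : t - 2 * x < √(t ^ 2 - 4 * x ^ 2) := by
    rw [Real.lt_sqrt (by linarith)]; nlinarith
  rw [smallRoot, div_lt_one (by linarith)]
  linarith

/-- `smallRoot x t` is the point of `(0, 1)` at which the decreasing function `x (r + r⁻¹)` equals
`t`, so it decreases in `t`. -/
theorem smallRoot_lt_smallRoot {x t u : ℝ} (hx : 0 < x) (ht : 2 * x < t) (htu : t < u) :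
    smallRoot x u < smallRoot x t := by
  have hu := ht.trans htu
  have h1 := smallRoot_add_inv hx ht
  have h2 := smallRoot_add_inv hx hu
  have p1 := smallRoot_pos hx ht
  have p2 := smallRoot_pos hx hu
  have l1 := smallRoot_lt_one hx ht
  have l2 := smallRoot_lt_one hx hu
  set r := smallRoot x t
  set s := smallRoot x u
  by_contra! hle
  have h3 : x * (s + s⁻¹) - x * (r + r⁻¹) = -(x * (s - r) * (1 - r * s)) / (r * s) := by
    field_simp; ring
  have h4 : 0 ≤ x * (s - r) * (1 - r * s) :=
    mul_nonneg (mul_nonneg hx.le (by linarith)) (by nlinarith)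
  have h5 : -(x * (s - r) * (1 - r * s)) / (r * s) ≤ 0 :=
    div_nonpos_of_nonpos_of_nonneg (by linarith) (by positivity)
  linarith

/-- The factorization of one quadratic factor of the quartics. -/
theorem quadratic_factor {x t : ℝ} (hx : 0 < x) (ht : 2 * x < t) (ξ : ℂ) :
    x * (ξ ^ 2 + 1) - t * ξ =
      x * ((ξ - smallRoot x t) * (ξ - ((smallRoot x t)⁻¹ : ℝ))) := by
  have h : (x : ℂ) * (smallRoot x t + ((smallRoot x t)⁻¹ : ℝ)) = t := by
    exact_mod_cast smallRoot_add_inv hx ht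
  have h2 : (smallRoot x t : ℂ) * ((smallRoot x t)⁻¹ : ℝ) = 1 := by
    exact_mod_cast mul_inv_cancel₀ (smallRoot_pos hx ht).ne'
  linear_combination ξ * h - x * h2

theorem c1_eq (x : ℝ) : c1 x = smallRoot x (1 + 2 * x) := by
  rw [c1, smallRoot]; congr 3; ring

theorem c2_eq (x : ℝ) : c2 x = smallRoot x (1 - 2 * x) := by
  rw [c2, smallRoot]; congr 3; ring

theorem sq_sqrt_four_mul_sq_add (x w : ℝ) :
    √(4 * x ^ 2 + w ^ 2) ^ 2 = 4 * x ^ 2 + w ^ 2 := Real.sq_sqrt (by positivity)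

theorem a1_eq (x w : ℝ) : a1 x w = smallRoot x (1 + √(4 * x ^ 2 + w ^ 2)) := by
  rw [a1, smallRoot]; congr 3; linear_combination -(sq_sqrt_four_mul_sq_add x w)

theorem a2_eq (x w : ℝ) : a2 x w = smallRoot x (1 - √(4 * x ^ 2 + w ^ 2)) := by
  rw [a2, smallRoot]; congr 3; linear_combination -(sq_sqrt_four_mul_sq_add x w)

section Roots

variable {x : ℝ}

theorem d1_eq_inv (hx : 0 < x) (hx4 : 4 * x < 1) : d1 x = (c2 x)⁻¹ := by
  rw [c2_eq, ← largeRoot_eq hx (by linarith), d1]; congr 3; ring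

theorem d2_eq_inv (hx : 0 < x) (hx4 : 4 * x < 1) : d2 x = (c1 x)⁻¹ := by
  rw [c1_eq, ← largeRoot_eq hx (by linarith), d2]; congr 3; ring

theorem c1_pos (hx : 0 < x) : 0 < c1 x := by
  rw [c1_eq]; exact smallRoot_pos hx (by linarith)

theorem c1_lt_c2 (hx : 0 < x) (hx4 : 4 * x < 1) : c1 x < c2 x := by
  rw [c1_eq, c2_eq]; exact smallRoot_lt_smallRoot hx (by linarith) (by linarith)

theorem c2_pos (hx : 0 < x) (hx4 : 4 * x < 1) : 0 < c2 x := (c1_pos hx).trans (c1_lt_c2 hx hx4)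

theorem c2_lt_one (hx : 0 < x) (hx4 : 4 * x < 1) : c2 x < 1 := by
  rw [c2_eq]; exact smallRoot_lt_one hx (by linarith)

theorem one_lt_d1 (hx : 0 < x) (hx4 : 4 * x < 1) : 1 < d1 x := by
  rw [d1_eq_inv hx hx4]; exact one_lt_inv_iff₀.2 ⟨c2_pos hx hx4, c2_lt_one hx hx4⟩

theorem d1_lt_d2 (hx : 0 < x) (hx4 : 4 * x < 1) : d1 x < d2 x := by
  rw [d1_eq_inv hx hx4, d2_eq_inv hx hx4]
  exact inv_strictAnti₀ (c1_pos hx) (c1_lt_c2 hx hx4)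

theorem Q1_factor (hx : 0 < x) (hx4 : 4 * x < 1) (ξ : ℂ) :
    Q1 x ξ = x ^ 2 * ((ξ - c1 x) * (ξ - c2 x) * (ξ - d1 x) * (ξ - d2 x)) := by
  have h1 := quadratic_factor hx (show 2 * x < 1 + 2 * x by linarith) ξ
  have h2 := quadratic_factor hx (show 2 * x < 1 - 2 * x by linarith) ξ
  rw [← c1_eq, ← d2_eq_inv hx hx4] at h1
  rw [← c2_eq, ← d1_eq_inv hx hx4] at h2
  push_cast at h1 h2
  have h3 : Q1 x ξ = (x * (ξ ^ 2 + 1) - (1 + 2 * x) * ξ) * (x * (ξ ^ 2 + 1) - (1 - 2 * x) * ξ) := by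
    rw [Q1]; ring
  rw [h3, h1, h2]; ring

end Roots

theorem two_mul_lt_sqrt {x w : ℝ} (hw : 0 < w) :
    2 * x < √(4 * x ^ 2 + w ^ 2) := by
  apply Real.lt_sqrt_of_sq_lt
  nlinarith

theorem sqrt_lt_one_sub {x w : ℝ} (hx : 0 < x) (hxw : 4 * x + w ^ 2 < 1) :
    √(4 * x ^ 2 + w ^ 2) < 1 - 2 * x := by
  rw [Real.sqrt_lt' (by nlinarith)]
  nlinarith

/-- The four numbers are `smallRoot x t` at decreasing values of `t`. -/
theorem root_order {x w : ℝ} (hx : 0 < x) (hw : 0 < w) (hxw : 4 * x + w ^ 2 < 1) :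
    0 < a1 x w ∧ a1 x w < c1 x ∧ c1 x < c2 x ∧ c2 x < a2 x w ∧ a2 x w < 1 := by
  have h1 := two_mul_lt_sqrt (x := x) hw
  have h2 := sqrt_lt_one_sub hx hxw
  refine ⟨?_, ?_, c1_lt_c2 hx (by nlinarith), ?_, ?_⟩
  · rw [a1_eq]; exact smallRoot_pos hx (by linarith)
  · rw [a1_eq, c1_eq]; exact smallRoot_lt_smallRoot hx (by linarith) (by linarith)
  · rw [a2_eq, c2_eq]; exact smallRoot_lt_smallRoot hx (by linarith) (by linarith)
  · rw [a2_eq]; exact smallRoot_lt_one hx (by linarith)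

theorem b1_eq_inv {x w : ℝ} (hx : 0 < x) (hxw : 4 * x + w ^ 2 < 1) :
    b1 x w = (a2 x w)⁻¹ := by
  have h2 := sqrt_lt_one_sub hx hxw
  rw [a2_eq, ← largeRoot_eq hx (by linarith), b1]
  congr 3; linear_combination -(sq_sqrt_four_mul_sq_add x w)

theorem b2_eq_inv {x w : ℝ} (hx : 0 < x) (hw : 0 < w) : b2 x w = (a1 x w)⁻¹ := by
  have h1 := two_mul_lt_sqrt (x := x) hw
  rw [a1_eq, ← largeRoot_eq hx (by linarith), b2]
  congr 3; linear_combination -(sq_sqrt_four_mul_sq_add x w)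

theorem Q2_factor {x w : ℝ} (hx : 0 < x) (hw : 0 < w) (hxw : 4 * x + w ^ 2 < 1) (ξ : ℂ) :
    Q2 x w ξ = x ^ 2 * ((ξ - a1 x w) * (ξ - a2 x w) * (ξ - b1 x w) * (ξ - b2 x w)) := by
  have h1 := two_mul_lt_sqrt (x := x) hw
  have h2 := sqrt_lt_one_sub hx hxw
  have f1 := quadratic_factor hx (show 2 * x < 1 + √(4 * x ^ 2 + w ^ 2) by linarith) ξ
  have f2 := quadratic_factor hx (show 2 * x < 1 - √(4 * x ^ 2 + w ^ 2) by linarith) ξ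
  rw [← a1_eq, ← b2_eq_inv hx hw] at f1
  rw [← a2_eq, ← b1_eq_inv hx hxw] at f2
  push_cast at f1 f2
  have hs : (√(4 * x ^ 2 + w ^ 2) : ℂ) ^ 2 = 4 * x ^ 2 + w ^ 2 := by
    exact_mod_cast sq_sqrt_four_mul_sq_add x w
  have h3 : Q2 x w ξ = (x * (ξ ^ 2 + 1) - (1 + √(4 * x ^ 2 + w ^ 2)) * ξ) *
      (x * (ξ ^ 2 + 1) - (1 - √(4 * x ^ 2 + w ^ 2)) * ξ) := by
    rw [Q2, Q1]; linear_combination ξ ^ 2 * hs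
  rw [h3, f1, f2]; ring

/-! ### The continuation of `g` and its boundary values -/

/-- A closed form of the continuation of `g x`; the sign is that of `g x` on `(c₂, d₁)`. -/
noncomputable def gExt (x : ℝ) (ξ : ℂ) : ℂ :=
  -(x * cutSqrt (c1 x) (c2 x) ξ * cutSqrt (d1 x) (d2 x) ξ)

section Continuation

variable {x : ℝ}

theorem notMem_of_mem_D4 {ξ : ℂ} (h : ξ ∈ D4 x) :
    ξ ∉ Complex.ofReal '' Set.Icc (c1 x) (c2 x) ∧ ξ ∉ Complex.ofReal '' Set.Icc (d1 x) (d2 x) := by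
  rw [D4, Set.image_union, Set.mem_compl_iff, Set.mem_union, not_or] at h
  exact h

theorem mem_D3_of_im_ne_zero {ξ : ℂ} (h : ξ.im ≠ 0) : ξ ∈ D3 x := by
  rintro ⟨r, _, rfl⟩; simp at h

theorem isOpen_D4 (x : ℝ) : IsOpen (D4 x) := by
  rw [D4, isOpen_compl_iff]
  exact Complex.isometry_ofReal.isClosedEmbedding.isClosedMap _ (isClosed_Icc.union isClosed_Icc)

theorem slitPlane_of_notMem_Iic {ξ : ℂ} {a : ℝ} (h : ∀ r : ℝ, r ≤ a → (r : ℂ) ≠ ξ) :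
    ξ - a ∈ Complex.slitPlane := by
  by_contra hn
  simp only [Complex.mem_slitPlane_iff, not_or, not_lt, not_not, Complex.sub_re, Complex.sub_im,
    Complex.ofReal_re, Complex.ofReal_im, sub_zero] at hn
  refine h ξ.re (by linarith) ?_
  apply Complex.ext <;> simp [hn.2]

/-- Off `(-∞, b]` the two principal square roots combine to the cut square root. -/
theorem sqrt_mul_sqrt_eq_cutSqrt {a b : ℝ} {ξ : ℂ} (ha : ξ - a ∈ Complex.slitPlane)
    (hb : ξ - b ∈ Complex.slitPlane) :
    Complex.sqrt (ξ - a) * Complex.sqrt (ξ - b) = cutSqrt a b ξ := by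
  have hs : Complex.sqrt (ξ - a) ≠ 0 := fun h => by
    have := Complex.re_sqrt_pos ha; simp [h] at this
  rw [cutSqrt, Complex.sqrt_div_of_im hb ha (Complex.sqrt_im_mul_im_nonneg (by
    simp only [Complex.sub_im, Complex.ofReal_im, sub_zero, and_self]; exact le_or_gt _ _))]
  nth_rewrite 2 [← Complex.sqrt_sq_eq (ξ - a)]
  field_simp

/-- Off `[a, ∞)` the two principal square roots combine to the opposite of the cut square root. -/
theorem sqrt_mul_sqrt_eq_neg_cutSqrt {a b : ℝ} {ξ : ℂ} (ha : a - ξ ∈ Complex.slitPlane)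
    (hb : b - ξ ∈ Complex.slitPlane) :
    Complex.sqrt (a - ξ) * Complex.sqrt (b - ξ) = -cutSqrt a b ξ := by
  have hs : Complex.sqrt (a - ξ) ≠ 0 := fun h => by
    have := Complex.re_sqrt_pos ha; simp [h] at this
  have h1 : (ξ - b) / (ξ - a) = (b - ξ) / (a - ξ) := by
    rw [← neg_sub (b : ℂ) ξ, ← neg_sub (a : ℂ) ξ, neg_div_neg_eq]
  rw [cutSqrt, h1, Complex.sqrt_div_of_im hb ha (Complex.sqrt_im_mul_im_nonneg (by
    simp only [Complex.sub_im, Complex.ofReal_im, zero_sub, and_self]; exact le_or_gt _ _)),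
    ← neg_sub (a : ℂ) ξ]
  nth_rewrite 2 [← Complex.sqrt_sq_eq (a - ξ)]
  field_simp

theorem g_eq_gExt (hx : 0 < x) (hx4 : 4 * x < 1) {ξ : ℂ} (h : ξ ∈ D3 x) : g x ξ = gExt x ξ := by
  have hc := c1_lt_c2 hx hx4
  have hd := d1_lt_d2 hx hx4
  have hl : ∀ r : ℝ, r ≤ c2 x → (r : ℂ) ≠ ξ := fun r hr he => h ⟨r, Or.inl hr, he⟩
  have hr : ∀ r : ℝ, d1 x ≤ r → (r : ℂ) ≠ ξ := fun r hr he => h ⟨r, Or.inr hr, he⟩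
  have hneg : ∀ d : ℝ, d1 x ≤ d → (d : ℂ) - ξ ∈ Complex.slitPlane := by
    intro d hd'
    have := slitPlane_of_notMem_Iic (ξ := -ξ) (a := -d) (fun r hr' he =>
      hr (-r) (by linarith) (by rw [Complex.ofReal_neg, he, neg_neg]))
    rwa [Complex.ofReal_neg, sub_neg_eq_add, neg_add_eq_sub] at this
  have e1 := sqrt_mul_sqrt_eq_cutSqrt (slitPlane_of_notMem_Iic fun r hr' => hl r (hr'.trans hc.le))
    (slitPlane_of_notMem_Iic hl)
  have e2 := sqrt_mul_sqrt_eq_neg_cutSqrt (hneg _ le_rfl) (hneg _ hd.le)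
  rw [g, gExt, ← e1]
  linear_combination (x : ℂ) * Complex.sqrt (ξ - c1 x) * Complex.sqrt (ξ - c2 x) * e2

theorem differentiableAt_gExt (hx : 0 < x) (hx4 : 4 * x < 1) {ξ : ℂ} (h : ξ ∈ D4 x) :
    DifferentiableAt ℂ (gExt x) ξ := by
  obtain ⟨h1, h2⟩ := notMem_of_mem_D4 h
  have e1 := differentiableAt_cutSqrt (c1_lt_c2 hx hx4) h1
  have e2 := differentiableAt_cutSqrt (d1_lt_d2 hx hx4) h2
  exact ((e1.const_mul (x : ℂ)).mul e2).neg

/-- On `D4 x` outside `D3 x` the limit that defines `gTilde` exists because `gExt` is continuous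
there and agrees with `g` off the real axis, whose complement is dense. -/
theorem gTilde_eq_gExt (hx : 0 < x) (hx4 : 4 * x < 1) {ξ : ℂ} (h : ξ ∈ D4 x) :
    gTilde x ξ = gExt x ξ := by
  rw [gTilde]
  split_ifs with h3
  · exact g_eq_gExt hx hx4 h3
  · have hne : (𝓝[{ζ : ℂ | ζ.im ≠ 0}] ξ).NeBot := by
      rw [← mem_closure_iff_nhdsWithin_neBot]
      have hd : Dense {ζ : ℂ | ζ.im ≠ 0} := by
        have := (dense_compl_singleton (0 : ℝ)).preimage Complex.isOpenMap_im
        exact this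
      exact hd ξ
    refine Tendsto.limUnder_eq ?_
    refine ((differentiableAt_gExt hx hx4 h).continuousAt.continuousWithinAt (s :=
      {ζ : ℂ | ζ.im ≠ 0})).tendsto.congr' ?_
    filter_upwards [self_mem_nhdsWithin] with ζ hζ
    exact (g_eq_gExt hx hx4 (mem_D3_of_im_ne_zero hζ)).symm

theorem analyticOnNhd_gTilde (hx : 0 < x) (hx4 : 4 * x < 1) :
    AnalyticOnNhd ℂ (gTilde x) (D4 x) := by
  have h : DifferentiableOn ℂ (gTilde x) (D4 x) := fun ξ hξ =>
    (differentiableAt_gExt hx hx4 hξ).differentiableWithinAt.congr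
      (fun ζ hζ => gTilde_eq_gExt hx hx4 hζ) (gTilde_eq_gExt hx hx4 hξ)
  exact h.analyticOnNhd (isOpen_D4 x)

theorem gExt_sq (hx : 0 < x) (hx4 : 4 * x < 1) {ξ : ℂ} (h : ξ ∈ D4 x) :
    gExt x ξ ^ 2 = Q1 x ξ := by
  obtain ⟨h1, h2⟩ := notMem_of_mem_D4 h
  have e1 := cutSqrt_sq (b := c2 x) (sub_ofReal_ne_zero h1 ⟨le_rfl, (c1_lt_c2 hx hx4).le⟩)
  have e2 := cutSqrt_sq (b := d2 x) (sub_ofReal_ne_zero h2 ⟨le_rfl, (d1_lt_d2 hx hx4).le⟩)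
  rw [Q1_factor hx hx4, gExt, neg_sq, mul_pow, mul_pow, e1, e2]
  ring

/-- The principal square root is continuous up to its cut from the closed upper half-plane. -/
theorem Complex.tendsto_sqrt_add (r : ℝ) :
    Tendsto (fun ε : ℝ => Complex.sqrt (r + Complex.I * ε)) (𝓝[>] 0)
      (𝓝 (Complex.sqrt r)) := by
  have hf : Continuous fun ε : ℝ => (√((‖(r + Complex.I * ε : ℂ)‖ + r) / 2) : ℂ) +
      √((‖(r + Complex.I * ε : ℂ)‖ - r) / 2) * Complex.I := by fun_prop
  have h0 := (hf.tendsto 0).mono_left (nhdsWithin_le_nhds (s := Set.Ioi 0))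
  have e0 : Complex.sqrt r = (√((‖(r + Complex.I * (0 : ℝ) : ℂ)‖ + r) / 2) : ℂ) +
      √((‖(r + Complex.I * (0 : ℝ) : ℂ)‖ - r) / 2) * Complex.I := by
    rw [Complex.sqrt_eq_real_add_ite]; simp
  rw [e0]
  refine h0.congr' ?_
  filter_upwards [self_mem_nhdsWithin] with ε hε
  rw [Complex.sqrt_eq_real_add_ite]
  simp [le_of_lt (Set.mem_Ioi.1 hε)]

/-- From below, the principal square root tends to the conjugate of its value on the cut. -/
theorem Complex.tendsto_sqrt_sub (r : ℝ) :
    Tendsto (fun ε : ℝ => Complex.sqrt (r - Complex.I * ε)) (𝓝[>] 0)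
      (𝓝 ((starRingEnd ℂ) (Complex.sqrt r))) := by
  refine ((Complex.continuous_conj.tendsto _).comp (Complex.tendsto_sqrt_add r)).congr' ?_
  filter_upwards [self_mem_nhdsWithin] with ε hε
  have hε' : 0 < ε := hε
  have hn : ‖(r - Complex.I * ε : ℂ)‖ = ‖(r + Complex.I * ε : ℂ)‖ := by
    rw [← Complex.norm_conj]; simp
  simp only [Function.comp]
  rw [Complex.sqrt_eq_real_add_ite, Complex.sqrt_eq_real_add_ite, hn]
  simp [hε'.le, not_le.2 hε']

theorem Complex.sqrt_ofReal_of_nonneg {r : ℝ} (hr : 0 ≤ r) : Complex.sqrt r = (√r : ℂ) := by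
  rw [Complex.sqrt_eq_real_add_ite]; simp [abs_of_nonneg hr]

theorem Complex.sqrt_ofReal_of_nonpos {r : ℝ} (hr : r ≤ 0) :
    Complex.sqrt r = (√(-r) : ℂ) * Complex.I := by
  rw [Complex.sqrt_eq_real_add_ite]
  have : (-r - r) / 2 = -r := by ring
  simp [abs_of_nonpos hr, this]

/-- The boundary values of `gTilde x` at `r ∈ [c₁, c₂]` are `± i` times this nonnegative number: the
factor `cutSqrt (d1 x) (d2 x) r` is negative. -/
noncomputable def cutDensity (x r : ℝ) : ℂ :=
  -(x * (√((r - c1 x) * (c2 x - r)) : ℂ) * cutSqrt (d1 x) (d2 x) r)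

theorem ofReal_notMem_image {a b r : ℝ} (hr : r ∉ Set.Icc a b) :
    (r : ℂ) ∉ Complex.ofReal '' Set.Icc a b := by
  rintro ⟨s, hs, h⟩
  exact hr (Complex.ofReal_injective h ▸ hs)

/-- Near the cut `[c₁, c₂]` only the factor `√(ξ - c₂)` jumps. -/
theorem tendsto_gTilde (hx : 0 < x) (hx4 : 4 * x < 1) {r : ℝ} (hr : r ∈ Set.Icc (c1 x) (c2 x))
    {u : ℝ → ℂ} (hu : Tendsto u (𝓝[>] 0) (𝓝 (r : ℂ))) (hu' : ∀ᶠ ε in 𝓝[>] 0, (u ε).im ≠ 0)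
    {p q : ℂ} (hp : Tendsto (fun ε => Complex.sqrt (u ε - c1 x)) (𝓝[>] 0) (𝓝 p))
    (hq : Tendsto (fun ε => Complex.sqrt (u ε - c2 x)) (𝓝[>] 0) (𝓝 q)) :
    Tendsto (fun ε => gTilde x (u ε)) (𝓝[>] 0)
      (𝓝 (-(x * (p * q) * cutSqrt (d1 x) (d2 x) r))) := by
  have hrd : r ∉ Set.Icc (d1 x) (d2 x) := fun h => by
    have := one_lt_d1 hx hx4; have := c2_lt_one hx hx4; linarith [hr.2, h.1]
  have hk := (differentiableAt_cutSqrt (d1_lt_d2 hx hx4)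
    (ofReal_notMem_image hrd)).continuousAt.tendsto.comp hu
  refine (((hp.mul hq).const_mul (x : ℂ)).mul hk).neg.congr' ?_
  filter_upwards [hu'] with ε hε
  have hs : ∀ a : ℝ, u ε - a ∈ Complex.slitPlane := fun a => by
    rw [Complex.mem_slitPlane_iff]; right; simpa using hε
  rw [gTilde, if_pos (mem_D3_of_im_ne_zero hε), g_eq_gExt hx hx4 (mem_D3_of_im_ne_zero hε), gExt,
    Function.comp, sqrt_mul_sqrt_eq_cutSqrt (hs _) (hs _)]

theorem tendsto_gTilde_add (hx : 0 < x) (hx4 : 4 * x < 1) {r : ℝ}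
    (hr : r ∈ Set.Icc (c1 x) (c2 x)) :
    Tendsto (fun ε : ℝ => gTilde x ((r : ℂ) + Complex.I * ε)) (𝓝[>] 0)
      (𝓝 (Complex.I * cutDensity x r)) := by
  have hu : Tendsto (fun ε : ℝ => (r : ℂ) + Complex.I * ε) (𝓝[>] 0) (𝓝 (r : ℂ)) := by
    have hc : Continuous fun ε : ℝ => (r : ℂ) + Complex.I * ε := by fun_prop
    have := (hc.tendsto 0).mono_left (nhdsWithin_le_nhds (s := Set.Ioi 0))
    simpa using this
  have hs : ∀ a : ℝ, Tendsto (fun ε : ℝ => Complex.sqrt ((r : ℂ) + Complex.I * ε - a)) (𝓝[>] 0)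
      (𝓝 (Complex.sqrt ((r - a : ℝ) : ℂ))) := fun a => by
    refine (Complex.tendsto_sqrt_add (r - a)).congr fun ε => ?_
    congr 1; push_cast; ring
  have h := tendsto_gTilde hx hx4 hr hu (by
    filter_upwards [self_mem_nhdsWithin] with ε hε
    simpa using (ne_of_gt hε)) (hs _) (hs _)
  convert h using 2
  rw [Complex.sqrt_ofReal_of_nonneg (by linarith [hr.1]),
    Complex.sqrt_ofReal_of_nonpos (by linarith [hr.2]), cutDensity,
    Real.sqrt_mul (by linarith [hr.1]), neg_sub]
  push_cast; ring

theorem tendsto_gTilde_sub (hx : 0 < x) (hx4 : 4 * x < 1) {r : ℝ}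
    (hr : r ∈ Set.Icc (c1 x) (c2 x)) :
    Tendsto (fun ε : ℝ => gTilde x ((r : ℂ) - Complex.I * ε)) (𝓝[>] 0)
      (𝓝 (-(Complex.I * cutDensity x r))) := by
  have hu : Tendsto (fun ε : ℝ => (r : ℂ) - Complex.I * ε) (𝓝[>] 0) (𝓝 (r : ℂ)) := by
    have hc : Continuous fun ε : ℝ => (r : ℂ) - Complex.I * ε := by fun_prop
    have := (hc.tendsto 0).mono_left (nhdsWithin_le_nhds (s := Set.Ioi 0))
    simpa using this
  have hs : ∀ a : ℝ, Tendsto (fun ε : ℝ => Complex.sqrt ((r : ℂ) - Complex.I * ε - a)) (𝓝[>] 0)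
      (𝓝 ((starRingEnd ℂ) (Complex.sqrt ((r - a : ℝ) : ℂ)))) := fun a => by
    refine (Complex.tendsto_sqrt_sub (r - a)).congr fun ε => ?_
    congr 1; push_cast; ring
  have h := tendsto_gTilde hx hx4 hr hu (by
    filter_upwards [self_mem_nhdsWithin] with ε hε
    simpa using (ne_of_gt hε)) (hs _) (hs _)
  convert h using 2
  rw [Complex.sqrt_ofReal_of_nonneg (by linarith [hr.1]),
    Complex.sqrt_ofReal_of_nonpos (by linarith [hr.2]), cutDensity,
    Real.sqrt_mul (by linarith [hr.1]), neg_sub]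
  simp only [map_mul, Complex.conj_ofReal, Complex.conj_I]
  push_cast; ring

theorem gPlus_eq (hx : 0 < x) (hx4 : 4 * x < 1) {r : ℝ} (hr : r ∈ Set.Icc (c1 x) (c2 x)) :
    gPlus x r = Complex.I * cutDensity x r := (tendsto_gTilde_add hx hx4 hr).limUnder_eq

theorem gMinus_eq (hx : 0 < x) (hx4 : 4 * x < 1) {r : ℝ} (hr : r ∈ Set.Icc (c1 x) (c2 x)) :
    gMinus x r = -(Complex.I * cutDensity x r) := (tendsto_gTilde_sub hx hx4 hr).limUnder_eq

theorem I2_eq (hx : 0 < x) (hx4 : 4 * x < 1) {r : ℝ} (w : ℝ) (hr : r ∈ Set.Icc (c1 x) (c2 x)) :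
    I2 x w r = -(cutDensity x r / Q2 x w r) := by
  rw [I2, gPlus_eq hx hx4 hr, gMinus_eq hx hx4 hr]
  have : Complex.I * (Complex.I * cutDensity x r) - Complex.I * -(Complex.I * cutDensity x r) =
      2 * -cutDensity x r := by
    linear_combination 2 * cutDensity x r * Complex.I_mul_I
  rw [this, mul_div_mul_left _ _ two_ne_zero, neg_div]

/-! ### The unit circle -/

theorem mem_D4_of_norm_eq_one (hx : 0 < x) (hx4 : 4 * x < 1) {ξ : ℂ} (hξ : ‖ξ‖ = 1) :
    ξ ∈ D4 x := by
  rintro ⟨r, hr | hr, rfl⟩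
  · have h0 := c1_pos hx; have h1 := c2_lt_one hx hx4
    rw [Complex.norm_real, Real.norm_eq_abs, abs_of_pos (h0.trans_le hr.1)] at hξ
    linarith [hr.2]
  · have h1 := one_lt_d1 hx hx4
    rw [Complex.norm_real, Real.norm_eq_abs, abs_of_pos (by linarith [hr.1])] at hξ
    linarith [hr.1]

/-- On the unit circle the roots `c` and `1 / c` are mirror images, so that the arguments of the
square roots cancel and leave a positive multiple of `ξ`. -/
theorem exists_gExt_eq_mul (hx : 0 < x) (hx4 : 4 * x < 1) {ξ : ℂ} (hξ : ‖ξ‖ = 1) :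
    ∃ p : ℝ, 0 < p ∧ gExt x ξ = ξ * p := by
  obtain ⟨h1, -⟩ := notMem_of_mem_D4 (mem_D4_of_norm_eq_one hx hx4 hξ)
  have hc1 := c1_pos hx
  have hc2 := c2_pos hx hx4
  have hcc := c1_lt_c2 hx hx4
  have n1 : ξ - c1 x ≠ 0 := sub_ofReal_ne_zero h1 ⟨le_rfl, hcc.le⟩
  have n2 : ξ - c2 x ≠ 0 := sub_ofReal_ne_zero h1 ⟨hcc.le, le_rfl⟩
  have hconj : ξ * (starRingEnd ℂ) ξ = 1 := by
    rw [Complex.mul_conj, Complex.normSq_eq_norm_sq, hξ]; simp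
  have hξ0 : ξ ≠ 0 := fun h => by simp [h] at hξ
  set v : ℂ := (ξ - c2 x) / (ξ - c1 x) with hv
  have hsv := Complex.re_sqrt_pos (div_sub_mem_slitPlane hcc h1)
  rw [← hv] at hsv
  have hsq := Complex.sqrt_sq_eq v
  set s := Complex.sqrt v with hs
  have hs0 : s ≠ 0 := fun h => by simp [h] at hsv
  have hcs0 : (starRingEnd ℂ) s ≠ 0 := by simpa using hs0
  have hC1 : (c1 x : ℂ) ≠ 0 := by exact_mod_cast hc1.ne'
  have hC2 : (c2 x : ℂ) ≠ 0 := by exact_mod_cast hc2.ne'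
  have hd1 : (d1 x : ℂ) = (c2 x : ℂ)⁻¹ := by rw [d1_eq_inv hx hx4]; simp
  have hd2 : (d2 x : ℂ) = (c1 x : ℂ)⁻¹ := by rw [d2_eq_inv hx hx4]; simp
  have m1 : ∀ c : ℝ, (c : ℂ) ≠ 0 →
      ξ - (c : ℂ)⁻¹ = -(ξ / c) * (starRingEnd ℂ) (ξ - c) := by
    intro c hc
    rw [map_sub, Complex.conj_ofReal]
    field_simp
    linear_combination hconj
  have hroot : Complex.sqrt ((ξ - d2 x) / (ξ - d1 x)) =
      (√(c2 x / c1 x) : ℂ) / (starRingEnd ℂ) s := by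
    refine Complex.eq_sqrt_of_sq_eq ?_ ?_
    · rw [div_pow, ← map_pow, hsq, hv, hd1, hd2, m1 _ hC1, m1 _ hC2, map_div₀]
      have n1' : (starRingEnd ℂ) (ξ - c1 x) ≠ 0 := (map_ne_zero _).2 n1
      have n2' : (starRingEnd ℂ) (ξ - c2 x) ≠ 0 := (map_ne_zero _).2 n2
      have : (√(c2 x / c1 x) : ℂ) ^ 2 = c2 x / c1 x := by
        exact_mod_cast Real.sq_sqrt (div_pos hc2 hc1).le
      rw [this]
      field_simp
    · rw [Complex.div_re]
      have : 0 < √(c2 x / c1 x) := Real.sqrt_pos.2 (div_pos hc2 hc1)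
      have h3 := Complex.normSq_pos.2 hcs0
      simp only [Complex.ofReal_re, Complex.ofReal_im, Complex.conj_re, zero_mul, zero_div,
        add_zero]
      positivity
  refine ⟨x * √(c2 x / c1 x) / c2 x * Complex.normSq (ξ - c2 x) / Complex.normSq s, ?_, ?_⟩
  · have : 0 < √(c2 x / c1 x) := Real.sqrt_pos.2 (div_pos hc2 hc1)
    have := Complex.normSq_pos.2 n2
    have := Complex.normSq_pos.2 hs0
    positivity
  · rw [gExt, cutSqrt, cutSqrt, hroot, ← hv, ← hs, hd1, m1 _ hC2]
    push_cast
    rw [Complex.normSq_eq_conj_mul_self, Complex.normSq_eq_conj_mul_self]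
    have e : (ξ - c1 x) * s ^ 2 = ξ - c2 x := by rw [hsq, hv]; field_simp
    field_simp
    linear_combination (x : ℂ) * (starRingEnd ℂ) (ξ - c2 x) * √(c2 x / c1 x) * e

/-- The value `√((1 - 2x cos θ)² - 4x²)` of `gTilde x ξ / ξ` at `ξ = exp (θ i)`, as a function of
`c = cos θ`. Its reciprocal is the generating function of the squared binomial coefficients. -/
noncomputable def radial (x c : ℝ) : ℝ := √((1 - 2 * x * c) ^ 2 - 4 * x ^ 2)

theorem le_radicand (hx : 0 < x) (hx4 : 4 * x < 1) {c : ℝ} (hc : c ≤ 1) :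
    1 - 4 * x ≤ (1 - 2 * x * c) ^ 2 - 4 * x ^ 2 := by
  have h : 1 - 2 * x ≤ 1 - 2 * x * c := by nlinarith
  nlinarith

theorem one_sub_sub_div_eq {ξ : ℂ} (hξ : ‖ξ‖ = 1) :
    1 - x * ξ - x / ξ = ((1 - 2 * x * ξ.re : ℝ) : ℂ) := by
  have hconj : ξ * (starRingEnd ℂ) ξ = 1 := by
    rw [Complex.mul_conj, Complex.normSq_eq_norm_sq, hξ]; simp
  have h := Complex.add_conj ξ
  push_cast at h
  rw [div_eq_mul_inv, inv_eq_of_mul_eq_one_right hconj]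
  push_cast
  linear_combination (-x : ℂ) * h

theorem sqrt_eq_radial (hx : 0 < x) (hx4 : 4 * x < 1) {ξ : ℂ} (hξ : ‖ξ‖ = 1) :
    Complex.sqrt ((1 - x * ξ - x / ξ) ^ 2 - 4 * x ^ 2) = (radial x ξ.re : ℂ) := by
  have hre : ξ.re ≤ 1 := hξ ▸ Complex.re_le_norm ξ
  have := le_radicand hx hx4 hre
  rw [one_sub_sub_div_eq hξ, radial, ← Complex.sqrt_ofReal_of_nonneg (by linarith)]
  push_cast; rfl

theorem gTilde_eq_mul_radial (hx : 0 < x) (hx4 : 4 * x < 1) {ξ : ℂ} (hξ : ‖ξ‖ = 1) :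
    gTilde x ξ = ξ * radial x ξ.re := by
  have hmem := mem_D4_of_norm_eq_one hx hx4 hξ
  have hξ0 : ξ ≠ 0 := fun h => by simp [h] at hξ
  obtain ⟨p, hp, he⟩ := exists_gExt_eq_mul hx hx4 hξ
  have hsq := gExt_sq hx hx4 hmem
  have hQ : Q1 x ξ = ξ ^ 2 * ((1 - x * ξ - x / ξ) ^ 2 - 4 * x ^ 2) := by
    rw [Q1]; field_simp; ring
  rw [he, hQ, one_sub_sub_div_eq hξ, mul_pow] at hsq
  have h1 := mul_left_cancel₀ (pow_ne_zero 2 hξ0) hsq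
  have h2 : p ^ 2 = (1 - 2 * x * ξ.re) ^ 2 - 4 * x ^ 2 := by exact_mod_cast h1
  rw [gTilde_eq_gExt hx hx4 hmem, he, radial, ← h2, Real.sqrt_sq hp.le]

theorem lt_radial {w : ℝ} (hx : 0 < x) (hxw : 4 * x + w ^ 2 < 1) {c : ℝ}
    (hc : c ≤ 1) : w < radial x c := by
  have := le_radicand hx (by nlinarith) hc
  exact Real.lt_sqrt_of_sq_lt (by linarith)

/-- Rationalizing the denominator of the circle integral gives the meromorphic integrand. -/
theorem integrand_eq {w : ℝ} (hx : 0 < x) (hw : 0 < w) (hxw : 4 * x + w ^ 2 < 1) {ξ : ℂ}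
    (hξ : ‖ξ‖ = 1) :
    integrand x w ξ =
      1 / (Complex.sqrt ((1 - x * ξ - x / ξ) ^ 2 - 4 * x ^ 2) - w) * (1 / ξ) := by
  have hx4 : 4 * x < 1 := by nlinarith
  have hmem := mem_D4_of_norm_eq_one hx hx4 hξ
  have hξ0 : ξ ≠ 0 := fun h => by simp [h] at hξ
  have hlt := lt_radial hx hxw (hξ ▸ Complex.re_le_norm ξ)
  have hQ : Q2 x w ξ = ξ ^ 2 * ((radial x ξ.re - w) * (radial x ξ.re + w)) := by
    rw [Q2, ← gExt_sq hx hx4 hmem, ← gTilde_eq_gExt hx hx4 hmem, gTilde_eq_mul_radial hx hx4 hξ]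
    ring
  rw [integrand, hQ, gTilde_eq_mul_radial hx hx4 hξ, sqrt_eq_radial hx hx4 hξ]
  have e1 : (radial x ξ.re - w : ℂ) ≠ 0 := by
    have : radial x ξ.re - w ≠ 0 := by linarith
    exact_mod_cast this
  have e2 : (radial x ξ.re + w : ℂ) ≠ 0 := by
    have : radial x ξ.re + w ≠ 0 := by linarith
    exact_mod_cast this
  field_simp
  ring

end Continuation

/-! ### Shrinking the contour to the cut -/

section Contour

theorem sub_ne_zero_of_norm {ξ p : ℂ} (hξ : ‖ξ‖ = 1) (hp : ‖p‖ < 1) : ξ - p ≠ 0 :=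
  fun h => hp.ne (sub_eq_zero.1 h ▸ hξ)

theorem continuousOn_pole {F : ℂ → ℂ} (hF : ContinuousOn F (Metric.sphere 0 1)) {p : ℂ}
    (hp : ‖p‖ < 1) : ContinuousOn (fun ξ => (ξ - p)⁻¹ * F ξ) (Metric.sphere 0 1) := by
  refine ContinuousOn.mul (ContinuousOn.inv₀ (by fun_prop) fun ξ hξ => ?_) hF
  exact sub_ne_zero_of_norm (mem_sphere_zero_iff_norm.1 hξ) hp

theorem circleIntegral_one_pole {F : ℂ → ℂ} (hF : DifferentiableOn ℂ F (Metric.closedBall 0 1))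
    {p : ℂ} (hp : ‖p‖ < 1) :
    ∮ ξ in C(0, 1), (ξ - p)⁻¹ * F ξ = 2 * Real.pi * Complex.I * F p :=
  hF.circleIntegral_sub_inv_smul (by simpa using hp)

/-- Partial fractions: an integral with two of the poles splits into two with one pole less. -/
theorem circleIntegral_split {G : ℂ → ℂ} (hG : ContinuousOn G (Metric.sphere 0 1)) {p q : ℂ}
    (hp : ‖p‖ < 1) (hq : ‖q‖ < 1) (hpq : p ≠ q) :
    ∮ ξ in C(0, 1), (ξ - p)⁻¹ * ((ξ - q)⁻¹ * G ξ) =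
      (p - q)⁻¹ * ((∮ ξ in C(0, 1), (ξ - p)⁻¹ * G ξ) - ∮ ξ in C(0, 1), (ξ - q)⁻¹ * G ξ) := by
  rw [← circleIntegral.integral_sub ((continuousOn_pole hG hp).circleIntegrable zero_le_one)
      ((continuousOn_pole hG hq).circleIntegrable zero_le_one),
    ← circleIntegral.integral_const_mul]
  refine circleIntegral.integral_congr zero_le_one fun ξ hξ => ?_
  have h1 := sub_ne_zero_of_norm (mem_sphere_zero_iff_norm.1 hξ) hp
  have h2 := sub_ne_zero_of_norm (mem_sphere_zero_iff_norm.1 hξ) hq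
  have h3 := sub_ne_zero.2 hpq
  field_simp
  ring

theorem circleIntegral_two_poles {F : ℂ → ℂ} (hF : DifferentiableOn ℂ F (Metric.closedBall 0 1))
    {p q : ℂ} (hp : ‖p‖ < 1) (hq : ‖q‖ < 1) (hpq : p ≠ q) :
    ∮ ξ in C(0, 1), (ξ - p)⁻¹ * ((ξ - q)⁻¹ * F ξ) =
      2 * Real.pi * Complex.I * (F p / (p - q) + F q / (q - p)) := by
  rw [circleIntegral_split (hF.continuousOn.mono Metric.sphere_subset_closedBall) hp hq hpq,
    circleIntegral_one_pole hF hp, circleIntegral_one_pole hF hq, ← neg_sub p q, div_neg]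
  ring

theorem circleIntegral_three_poles {F : ℂ → ℂ}
    (hF : DifferentiableOn ℂ F (Metric.closedBall 0 1)) {p q r : ℂ} (hp : ‖p‖ < 1) (hq : ‖q‖ < 1)
    (hr : ‖r‖ < 1) (hpq : p ≠ q) (hpr : p ≠ r) (hqr : q ≠ r) :
    ∮ ξ in C(0, 1), (ξ - p)⁻¹ * ((ξ - q)⁻¹ * ((ξ - r)⁻¹ * F ξ)) =
      2 * Real.pi * Complex.I * (F p / (p - q) * (p - r)⁻¹ + F q / (q - p) * (q - r)⁻¹ +
        F r / ((r - p) * (r - q))) := by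
  rw [circleIntegral_split (continuousOn_pole
      (hF.continuousOn.mono Metric.sphere_subset_closedBall) hr) hp hq hpq,
    circleIntegral_two_poles hF hp hr hpr, circleIntegral_two_poles hF hq hr hqr]
  have h1 := sub_ne_zero.2 hpq
  have h2 := sub_ne_zero.2 hpr
  have h3 := sub_ne_zero.2 hqr
  rw [← neg_sub p q, ← neg_sub p r, ← neg_sub q r]
  field_simp
  ring

variable {a b : ℝ}

theorem norm_lt_one_of_mem (ha : -1 < a) (hb : b < 1) {r : ℝ} (hr : r ∈ Set.Icc a b) :
    ‖(r : ℂ)‖ < 1 := by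
  rw [Complex.norm_real, Real.norm_eq_abs, abs_lt]
  exact ⟨by linarith [hr.1], by linarith [hr.2]⟩

/-- Fubini's theorem for the Stieltjes transform of the semicircle density. -/
theorem circleIntegral_integral_swap (hab : a < b) (ha : -1 < a) (hb : b < 1) {G : ℂ → ℂ}
    (hG : ContinuousOn G (Metric.sphere 0 1)) :
    ∮ ξ in C(0, 1), (∫ r in a..b, (√((r - a) * (b - r)) : ℂ) / (ξ - r)) * G ξ =
      ∫ r in a..b, (√((r - a) * (b - r)) : ℂ) * ∮ ξ in C(0, 1), (ξ - r)⁻¹ * G ξ := by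
  simp only [circleIntegral, smul_eq_mul]
  have h1 : ∀ θ : ℝ, deriv (circleMap 0 1) θ *
      ((∫ r in a..b, (√((r - a) * (b - r)) : ℂ) / (circleMap 0 1 θ - r)) * G (circleMap 0 1 θ)) =
      ∫ r in a..b, deriv (circleMap 0 1) θ * ((√((r - a) * (b - r)) : ℂ) /
        (circleMap 0 1 θ - r) * G (circleMap 0 1 θ)) := by
    intro θ
    rw [intervalIntegral.integral_const_mul, intervalIntegral.integral_mul_const]
  have hcirc : ∀ θ : ℝ, circleMap 0 1 θ ∈ Metric.sphere (0 : ℂ) 1 := fun θ =>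
    circleMap_mem_sphere 0 zero_le_one θ
  simp_rw [h1]
  rw [MeasureTheory.intervalIntegral_intervalIntegral_swap]
  · refine intervalIntegral.integral_congr fun r _ => ?_
    rw [← intervalIntegral.integral_const_mul]
    refine intervalIntegral.integral_congr fun θ _ => ?_
    ring
  · refine MeasureTheory.IntegrableOn.mono_set (t := Set.Icc 0 (2 * Real.pi) ×ˢ Set.Icc a b) ?_
      (Set.prod_mono ?_ ?_)
    · refine ContinuousOn.integrableOn_compact (isCompact_Icc.prod isCompact_Icc) ?_
      have hc : Continuous (circleMap 0 1) := continuous_circleMap 0 1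
      have hGc : Continuous fun θ : ℝ => G (circleMap 0 1 θ) := hG.comp_continuous hc hcirc
      simp only [deriv_circleMap, Function.uncurry_def]
      refine ContinuousOn.mul (by fun_prop) (ContinuousOn.mul (ContinuousOn.div ?_ ?_ ?_) ?_)
      · fun_prop
      · fun_prop
      · rintro ⟨θ, r⟩ ⟨_, hr⟩
        exact sub_ne_zero_of_norm (mem_sphere_zero_iff_norm.1 (hcirc θ))
          (norm_lt_one_of_mem ha hb hr)
      · exact (hGc.comp continuous_fst).continuousOn
    · rw [Set.uIoc_of_le Real.two_pi_pos.le]; exact Set.Ioc_subset_Icc_self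
    · rw [Set.uIoc_of_le hab.le]; exact Set.Ioc_subset_Icc_self

/-- Shrinking the unit circle to the cut `[a, b]` and two poles `p`, `q` for an integrand that
contains the cut square root. The Stieltjes representation of `cutSqrt` makes it a superposition
of rational functions with the additional pole `r ∈ [a, b]`; Cauchy's formula applies to each of
them, and the terms at `p` and `q` recombine to values of `cutSqrt`. -/
theorem circleIntegral_cutSqrt (hab : a < b) (ha : -1 < a) (hb : b < 1) {F : ℂ → ℂ}
    (hF : DifferentiableOn ℂ F (Metric.closedBall 0 1)) {p q : ℂ} (hp : ‖p‖ < 1) (hq : ‖q‖ < 1)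
    (hpq : p ≠ q) (hp' : p ∉ Complex.ofReal '' Set.Icc a b)
    (hq' : q ∉ Complex.ofReal '' Set.Icc a b) :
    ∮ ξ in C(0, 1), cutSqrt a b ξ * ((ξ - p)⁻¹ * ((ξ - q)⁻¹ * F ξ)) =
      2 * Real.pi * Complex.I * (cutSqrt a b p * F p / (p - q) + cutSqrt a b q * F q / (q - p) -
        (Real.pi : ℂ)⁻¹ * ∫ r in a..b,
          (√((r - a) * (b - r)) : ℂ) * (F r / ((r - p) * (r - q)))) := by
  have hFs := hF.continuousOn.mono Metric.sphere_subset_closedBall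
  have hπ : (Real.pi : ℂ) ≠ 0 := by exact_mod_cast Real.pi_ne_zero
  set Ψ : ℂ → ℂ := fun ξ => (ξ - p)⁻¹ * ((ξ - q)⁻¹ * F ξ) with hΨ
  have hΨc : ContinuousOn Ψ (Metric.sphere 0 1) := continuousOn_pole (continuousOn_pole hFs hq) hp
  have hS : ∀ ξ : ℂ, ξ ∉ Complex.ofReal '' Set.Icc a b → cutSqrt a b ξ =
      (ξ - (a + b) / 2) - (Real.pi : ℂ)⁻¹ *
        ∫ r in a..b, (√((r - a) * (b - r)) : ℂ) / (ξ - r) := by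
    intro ξ hξ
    rw [integral_semicircle_div_sub hab hξ]
    field_simp
    ring
  have hsph : ∀ ξ ∈ Metric.sphere (0 : ℂ) 1, ξ ∉ Complex.ofReal '' Set.Icc a b := by
    rintro _ hξ ⟨r, hr, rfl⟩
    exact (norm_lt_one_of_mem ha hb hr).ne (mem_sphere_zero_iff_norm.1 hξ)
  have hcut : ContinuousOn (cutSqrt a b) (Metric.sphere 0 1) := fun ξ hξ =>
    (differentiableAt_cutSqrt hab (hsph ξ hξ)).continuousAt.continuousWithinAt
  have hpoly : ContinuousOn (fun ξ : ℂ => ξ - (a + b) / 2) (Metric.sphere 0 1) := by fun_prop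
  have hSt : ContinuousOn (fun ξ : ℂ => (Real.pi : ℂ)⁻¹ *
      ∫ r in a..b, (√((r - a) * (b - r)) : ℂ) / (ξ - r)) (Metric.sphere 0 1) := by
    refine (hpoly.sub hcut).congr fun ξ hξ => ?_
    simp only [Pi.sub_apply]
    rw [hS ξ (hsph ξ hξ)]; ring
  have e1 : ∮ ξ in C(0, 1), cutSqrt a b ξ * Ψ ξ =
      (∮ ξ in C(0, 1), (ξ - (a + b) / 2) * Ψ ξ) - (Real.pi : ℂ)⁻¹ *
        ∮ ξ in C(0, 1), (∫ r in a..b, (√((r - a) * (b - r)) : ℂ) / (ξ - r)) * Ψ ξ := by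
    rw [← circleIntegral.integral_const_mul, ← circleIntegral.integral_sub]
    · refine circleIntegral.integral_congr zero_le_one fun ξ hξ => ?_
      rw [hS ξ (hsph ξ hξ)]; ring
    · exact (hpoly.mul hΨc).circleIntegrable zero_le_one
    · refine ((hSt.mul hΨc).congr fun ξ hξ => ?_).circleIntegrable zero_le_one
      simp only [Pi.mul_apply]; ring
  have e2 : ∮ ξ in C(0, 1), (ξ - (a + b) / 2) * Ψ ξ = 2 * Real.pi * Complex.I *
      ((p - (a + b) / 2) * F p / (p - q) + (q - (a + b) / 2) * F q / (q - p)) := by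
    rw [← circleIntegral_two_poles (F := fun ξ => (ξ - (a + b) / 2) * F ξ)
      (DifferentiableOn.mul (by fun_prop) hF) hp hq hpq]
    congr 1; ext ξ; simp only [hΨ]; ring
  have hpr : ∀ {r : ℝ}, r ∈ Set.Icc a b → p - r ≠ 0 := fun hr => sub_ofReal_ne_zero hp' hr
  have hqr : ∀ {r : ℝ}, r ∈ Set.Icc a b → q - r ≠ 0 := fun hr => sub_ofReal_ne_zero hq' hr
  have hsc : ∀ {H : ℝ → ℂ}, ContinuousOn H (Set.Icc a b) → IntervalIntegrable
      (fun r : ℝ => (√((r - a) * (b - r)) : ℂ) * H r) MeasureTheory.volume a b := by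
    intro H hH
    refine ContinuousOn.intervalIntegrable ?_
    rw [Set.uIcc_of_le hab.le]
    exact ContinuousOn.mul (by fun_prop) hH
  have hFr : ContinuousOn (fun r : ℝ => F r) (Set.Icc a b) :=
    hF.continuousOn.comp (by fun_prop) fun r hr => by
      simpa using (norm_lt_one_of_mem ha hb hr).le
  have c1 : ContinuousOn (fun r : ℝ => (p - r : ℂ)⁻¹) (Set.Icc a b) :=
    ContinuousOn.inv₀ (by fun_prop) fun r hr => hpr hr
  have c2 : ContinuousOn (fun r : ℝ => (q - r : ℂ)⁻¹) (Set.Icc a b) :=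
    ContinuousOn.inv₀ (by fun_prop) fun r hr => hqr hr
  have c3 : ContinuousOn (fun r : ℝ => F r / ((r - p) * (r - q))) (Set.Icc a b) :=
    hFr.div (by fun_prop) fun r hr => mul_ne_zero
      (by rw [← neg_sub]; exact neg_ne_zero.2 (hpr hr))
      (by rw [← neg_sub]; exact neg_ne_zero.2 (hqr hr))
  have e3 : (∫ r in a..b, (√((r - a) * (b - r)) : ℂ) * ∮ ξ in C(0, 1), (ξ - r)⁻¹ * Ψ ξ) =
      2 * Real.pi * Complex.I *
        (F p / (p - q) * (∫ r in a..b, (√((r - a) * (b - r)) : ℂ) / (p - r)) +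
          F q / (q - p) * (∫ r in a..b, (√((r - a) * (b - r)) : ℂ) / (q - r)) +
        ∫ r in a..b, (√((r - a) * (b - r)) : ℂ) * (F r / ((r - p) * (r - q)))) := by
    simp only [div_eq_mul_inv (Complex.ofReal _) (_ - _)]
    rw [← intervalIntegral.integral_const_mul, ← intervalIntegral.integral_const_mul,
      ← intervalIntegral.integral_add ((hsc c1).const_mul _) ((hsc c2).const_mul _),
      ← intervalIntegral.integral_add
        (((hsc c1).const_mul _).add ((hsc c2).const_mul _)) (hsc c3),
      ← intervalIntegral.integral_const_mul]
    refine intervalIntegral.integral_congr fun r hr => ?_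
    rw [Set.uIcc_of_le hab.le] at hr
    have h3 := circleIntegral_three_poles hF hp hq (norm_lt_one_of_mem ha hb hr) hpq
      (sub_ne_zero.1 (hpr hr)) (sub_ne_zero.1 (hqr hr))
    have h4 : (∮ ξ in C(0, 1), (ξ - r)⁻¹ * Ψ ξ) =
        ∮ ξ in C(0, 1), (ξ - p)⁻¹ * ((ξ - q)⁻¹ * ((ξ - r)⁻¹ * F ξ)) := by
      congr 1; ext ξ; simp only [hΨ]; ring
    rw [h4, h3]
    ring
  rw [e1, e2, circleIntegral_integral_swap hab ha hb hΨc, e3,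
    integral_semicircle_div_sub hab hp', integral_semicircle_div_sub hab hq']
  field_simp
  ring

end Contour

/-! ### The integrand on the unit circle and at its poles -/

section Residues

variable {x w : ℝ}

/-- The part of the integrand without singularities in the closed unit disc. -/
noncomputable def outerFactor (x w : ℝ) (ξ : ℂ) : ℂ :=
  (x ^ 2 * ((ξ - b1 x w) * (ξ - b2 x w)))⁻¹

theorem one_lt_b1 (hx : 0 < x) (hw : 0 < w) (hxw : 4 * x + w ^ 2 < 1) : 1 < b1 x w := by
  obtain ⟨h1, h2, h3, h4, h5⟩ := root_order hx hw hxw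
  rw [b1_eq_inv hx hxw]; exact one_lt_inv_iff₀.2 ⟨by linarith, h5⟩

theorem one_lt_b2 (hx : 0 < x) (hw : 0 < w) (hxw : 4 * x + w ^ 2 < 1) : 1 < b2 x w := by
  obtain ⟨h1, h2, h3, h4, h5⟩ := root_order hx hw hxw
  rw [b2_eq_inv hx hw]; exact one_lt_inv_iff₀.2 ⟨h1, by linarith⟩

theorem sub_ofReal_ne_zero_of_one_lt {ξ : ℂ} {b : ℝ} (hξ : ‖ξ‖ ≤ 1) (hb : 1 < b) :
    ξ - b ≠ 0 := fun h => by
  rw [sub_eq_zero.1 h, Complex.norm_real, Real.norm_eq_abs, abs_of_pos (by linarith)] at hξ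
  linarith

theorem outerFactor_ne_zero (hx : 0 < x) (hw : 0 < w) (hxw : 4 * x + w ^ 2 < 1) {ξ : ℂ}
    (hξ : ‖ξ‖ ≤ 1) : (x ^ 2 * ((ξ - b1 x w) * (ξ - b2 x w)) : ℂ) ≠ 0 := by
  have hx0 : (x : ℂ) ≠ 0 := by exact_mod_cast hx.ne'
  exact mul_ne_zero (pow_ne_zero 2 hx0) (mul_ne_zero
    (sub_ofReal_ne_zero_of_one_lt hξ (one_lt_b1 hx hw hxw))
    (sub_ofReal_ne_zero_of_one_lt hξ (one_lt_b2 hx hw hxw)))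

theorem differentiableAt_outerFactor (hx : 0 < x) (hw : 0 < w) (hxw : 4 * x + w ^ 2 < 1) {ξ : ℂ}
    (hξ : ‖ξ‖ ≤ 1) : DifferentiableAt ℂ (outerFactor x w) ξ :=
  DifferentiableAt.inv (by fun_prop) (outerFactor_ne_zero hx hw hxw hξ)

theorem inv_Q2 (hx : 0 < x) (hw : 0 < w) (hxw : 4 * x + w ^ 2 < 1) (ξ : ℂ) :
    (Q2 x w ξ)⁻¹ = (ξ - a1 x w)⁻¹ * ((ξ - a2 x w)⁻¹ * outerFactor x w ξ) := by
  rw [Q2_factor hx hw hxw, outerFactor, ← mul_inv, ← mul_inv]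
  congr 1; ring

theorem a1_mem_D4 (hx : 0 < x) (hw : 0 < w) (hxw : 4 * x + w ^ 2 < 1) : (a1 x w : ℂ) ∈ D4 x := by
  obtain ⟨h1, h2, h3, h4, h5⟩ := root_order hx hw hxw
  have hd := one_lt_d1 hx (by nlinarith)
  rintro ⟨r, hr, he⟩
  rw [Complex.ofReal_inj.1 he] at hr
  rcases hr with hr | hr <;> linarith [hr.1]

theorem a2_mem_D4 (hx : 0 < x) (hw : 0 < w) (hxw : 4 * x + w ^ 2 < 1) : (a2 x w : ℂ) ∈ D4 x := by
  obtain ⟨h1, h2, h3, h4, h5⟩ := root_order hx hw hxw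
  have hd := one_lt_d1 hx (by nlinarith)
  rintro ⟨r, hr, he⟩
  rw [Complex.ofReal_inj.1 he] at hr
  rcases hr with hr | hr <;> linarith [hr.1, hr.2]

/-- The residue of `(w ξ + gTilde ξ) / Q₂` at a simple pole, for either order of the two poles. -/
theorem tendsto_residue (hx : 0 < x) (hw : 0 < w) (hxw : 4 * x + w ^ 2 < 1) {p q : ℝ}
    (hp : (p : ℂ) ∈ D4 x) (hp1 : ‖(p : ℂ)‖ ≤ 1) (hpq : p ≠ q)
    (hQ : ∀ ξ : ℂ, (Q2 x w ξ)⁻¹ = (ξ - p)⁻¹ * ((ξ - q)⁻¹ * outerFactor x w ξ)) :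
    Tendsto (fun ξ : ℂ => (ξ - p) * integrand x w ξ) (𝓝[≠] (p : ℂ))
      (𝓝 ((w * p + gTilde x p) /
        (x ^ 2 * ((p - q) * (p - b1 x w) * (p - b2 x w))))) := by
  have hg : ContinuousAt (gTilde x) p :=
    ((analyticOnNhd_gTilde hx (by nlinarith)) _ hp).continuousAt
  have ho := (differentiableAt_outerFactor hx hw hxw hp1).continuousAt
  have hpq' : (p - q : ℂ) ≠ 0 := by
    have := sub_ne_zero.2 hpq
    exact_mod_cast this
  have hi : ContinuousAt (fun ξ : ℂ => (ξ - q)⁻¹) p :=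
    ContinuousAt.inv₀ (by fun_prop) hpq'
  have hc : ContinuousAt (fun ξ : ℂ => (w * ξ + gTilde x ξ) *
      ((ξ - q)⁻¹ * outerFactor x w ξ)) p :=
    ContinuousAt.mul (ContinuousAt.add (by fun_prop) hg) (hi.mul ho)
  have ht := hc.tendsto.mono_left (nhdsWithin_le_nhds (s := {(p : ℂ)}ᶜ))
  have hv : (w * p + gTilde x p) / (x ^ 2 * ((p - q) * (p - b1 x w) * (p - b2 x w))) =
      (w * (p : ℂ) + gTilde x p) * (((p : ℂ) - q)⁻¹ * outerFactor x w p) := by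
    rw [outerFactor, ← mul_inv, div_eq_mul_inv]
    congr 2; ring
  rw [hv]
  refine ht.congr' ?_
  filter_upwards [self_mem_nhdsWithin] with ξ hξ
  have hξ' : ξ - p ≠ 0 := sub_ne_zero.2 hξ
  rw [integrand, div_eq_mul_inv, hQ]
  field_simp

theorem norm_ofReal_lt_one {r : ℝ} (h0 : 0 < r) (h1 : r < 1) : ‖(r : ℂ)‖ < 1 := by
  rwa [Complex.norm_real, Real.norm_eq_abs, abs_of_pos h0]

theorem tendsto_res1 (hx : 0 < x) (hw : 0 < w) (hxw : 4 * x + w ^ 2 < 1) :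
    Tendsto (fun ξ : ℂ => (ξ - a1 x w) * integrand x w ξ) (𝓝[≠] (a1 x w : ℂ))
      (𝓝 (res1 x w)) := by
  obtain ⟨h1, h2, h3, h4, h5⟩ := root_order hx hw hxw
  exact tendsto_residue hx hw hxw (a1_mem_D4 hx hw hxw)
    (norm_ofReal_lt_one h1 (by linarith)).le (by linarith : a1 x w < a2 x w).ne
    (inv_Q2 hx hw hxw)

theorem tendsto_res2 (hx : 0 < x) (hw : 0 < w) (hxw : 4 * x + w ^ 2 < 1) :
    Tendsto (fun ξ : ℂ => (ξ - a2 x w) * integrand x w ξ) (𝓝[≠] (a2 x w : ℂ))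
      (𝓝 (res2 x w)) := by
  obtain ⟨h1, h2, h3, h4, h5⟩ := root_order hx hw hxw
  refine tendsto_residue hx hw hxw (a2_mem_D4 hx hw hxw)
    (norm_ofReal_lt_one (by linarith) h5).le (by linarith : a1 x w < a2 x w).ne' fun ξ => ?_
  rw [inv_Q2 hx hw hxw]; ring

theorem Q2_ne_zero_of_mem_cut (hx : 0 < x) (hw : 0 < w) (hxw : 4 * x + w ^ 2 < 1) {r : ℝ}
    (hr : r ∈ Set.Icc (c1 x) (c2 x)) : Q2 x w r ≠ 0 := by
  obtain ⟨h1, h2, h3, h4, h5⟩ := root_order hx hw hxw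
  have hr1 : ‖(r : ℂ)‖ < 1 := norm_ofReal_lt_one (by linarith [hr.1]) (by linarith [hr.2])
  have n1 : (r - a1 x w : ℂ) ≠ 0 := by
    have : r - a1 x w ≠ 0 := by linarith [hr.1]
    exact_mod_cast this
  have n2 : (r - a2 x w : ℂ) ≠ 0 := by
    have : r - a2 x w ≠ 0 := by linarith [hr.2]
    exact_mod_cast this
  have h := inv_Q2 hx hw hxw r
  intro h0
  rw [h0, inv_zero] at h
  exact mul_ne_zero (inv_ne_zero n1) (mul_ne_zero (inv_ne_zero n2)
    (inv_ne_zero (outerFactor_ne_zero hx hw hxw hr1.le))) h.symm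

theorem notMem_outer_cut (hx : 0 < x) (hx4 : 4 * x < 1) {ξ : ℂ} (hξ : ‖ξ‖ ≤ 1) :
    ξ ∉ Complex.ofReal '' Set.Icc (d1 x) (d2 x) := by
  rintro ⟨r, hr, rfl⟩
  have h1 := one_lt_d1 hx hx4
  rw [Complex.norm_real, Real.norm_eq_abs, abs_of_pos (by linarith [hr.1])] at hξ
  linarith [hr.1]

theorem intervalIntegrable_I2 (hx : 0 < x) (hw : 0 < w) (hxw : 4 * x + w ^ 2 < 1) :
    IntervalIntegrable (I2 x w) MeasureTheory.volume (c1 x) (c2 x) := by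
  have hx4 : 4 * x < 1 := by nlinarith
  have hc := c1_lt_c2 hx hx4
  refine ContinuousOn.intervalIntegrable ?_
  rw [Set.uIcc_of_le hc.le]
  have hk : ContinuousOn (fun r : ℝ => cutSqrt (d1 x) (d2 x) r) (Set.Icc (c1 x) (c2 x)) := by
    intro r hr
    have hr1 : ‖(r : ℂ)‖ ≤ 1 := (norm_ofReal_lt_one (by linarith [hr.1, c1_pos hx])
      (by linarith [hr.2, c2_lt_one hx hx4])).le
    have h1 := (differentiableAt_cutSqrt (d1_lt_d2 hx hx4)
      (notMem_outer_cut hx hx4 hr1)).continuousAt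
    exact (h1.comp (f := fun r : ℝ => (r : ℂ)) (by fun_prop)).continuousWithinAt
  have hd : ContinuousOn (cutDensity x) (Set.Icc (c1 x) (c2 x)) := by
    unfold cutDensity
    exact (ContinuousOn.mul (by fun_prop) hk).neg
  have hQ : ContinuousOn (fun r : ℝ => Q2 x w r) (Set.Icc (c1 x) (c2 x)) := by
    unfold Q2 Q1
    fun_prop
  exact (hd.div hQ fun r hr => Q2_ne_zero_of_mem_cut hx hw hxw hr).neg.congr
    fun r hr => I2_eq hx hx4 w hr

/-- The residue theorem for the integrand, with the cut `[c₁, c₂]` and the poles `a₁`, `a₂`. -/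
theorem circleIntegral_integrand (hx : 0 < x) (hw : 0 < w) (hxw : 4 * x + w ^ 2 < 1) :
    ∮ ξ in C(0, 1), integrand x w ξ = 2 * Real.pi * Complex.I * (calA1 x w + calA2 x w) := by
  have hx4 : 4 * x < 1 := by nlinarith
  obtain ⟨h1, h2, h3, h4, h5⟩ := root_order hx hw hxw
  have hc0 := c1_pos hx
  have hc1 := c2_lt_one hx hx4
  have hpq : (a1 x w : ℂ) ≠ a2 x w := by
    have : a1 x w ≠ a2 x w := by linarith
    exact_mod_cast this
  have hp := norm_ofReal_lt_one h1 (show a1 x w < 1 by linarith)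
  have hq := norm_ofReal_lt_one (show 0 < a2 x w by linarith) h5
  have hO : DifferentiableOn ℂ (outerFactor x w) (Metric.closedBall 0 1) := fun ξ hξ =>
    (differentiableAt_outerFactor hx hw hxw (by simpa using hξ)).differentiableWithinAt
  have hK : DifferentiableOn ℂ (cutSqrt (d1 x) (d2 x)) (Metric.closedBall 0 1) := fun ξ hξ =>
    (differentiableAt_cutSqrt (d1_lt_d2 hx hx4)
      (notMem_outer_cut hx hx4 (by simpa using hξ))).differentiableWithinAt
  have hF1 : DifferentiableOn ℂ (fun ξ => w * ξ * outerFactor x w ξ) (Metric.closedBall 0 1) :=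
    DifferentiableOn.mul (by fun_prop) hO
  have hF2 : DifferentiableOn ℂ (fun ξ => -x * cutSqrt (d1 x) (d2 x) ξ * outerFactor x w ξ)
      (Metric.closedBall 0 1) := (hK.const_mul _).mul hO
  obtain ⟨n1, -⟩ := notMem_of_mem_D4 (a1_mem_D4 hx hw hxw)
  obtain ⟨n2, -⟩ := notMem_of_mem_D4 (a2_mem_D4 hx hw hxw)
  have i1 := circleIntegral_two_poles hF1 hp hq hpq
  have i2 := circleIntegral_cutSqrt h3 (by linarith) hc1 hF2 hp hq hpq n1 n2
  have hcut : ContinuousOn (cutSqrt (c1 x) (c2 x)) (Metric.sphere 0 1) := fun ξ hξ =>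
    (differentiableAt_cutSqrt h3 (notMem_of_mem_D4 (mem_D4_of_norm_eq_one hx hx4
      (mem_sphere_zero_iff_norm.1 hξ))).1).continuousAt.continuousWithinAt
  have e : ∮ ξ in C(0, 1), integrand x w ξ =
      (∮ ξ in C(0, 1), (ξ - a1 x w)⁻¹ * ((ξ - a2 x w)⁻¹ * (w * ξ * outerFactor x w ξ))) +
      ∮ ξ in C(0, 1), cutSqrt (c1 x) (c2 x) ξ * ((ξ - a1 x w)⁻¹ * ((ξ - a2 x w)⁻¹ *
        (-x * cutSqrt (d1 x) (d2 x) ξ * outerFactor x w ξ))) := by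
    rw [← circleIntegral.integral_add]
    · refine circleIntegral.integral_congr zero_le_one fun ξ hξ => ?_
      have hD := mem_D4_of_norm_eq_one hx hx4 (mem_sphere_zero_iff_norm.1 hξ)
      rw [integrand, div_eq_mul_inv, inv_Q2 hx hw hxw, gTilde_eq_gExt hx hx4 hD, gExt]
      ring
    · exact (continuousOn_pole (continuousOn_pole (hF1.continuousOn.mono
        Metric.sphere_subset_closedBall) hq) hp).circleIntegrable zero_le_one
    · exact (hcut.mul (continuousOn_pole (continuousOn_pole (hF2.continuousOn.mono
        Metric.sphere_subset_closedBall) hq) hp)).circleIntegrable zero_le_one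
  have hA2 : calA2 x w = -((Real.pi : ℂ)⁻¹ * ∫ r in (c1 x)..(c2 x),
      (√((r - c1 x) * (c2 x - r)) : ℂ) * ((-x * cutSqrt (d1 x) (d2 x) r * outerFactor x w r) /
        ((r - a1 x w) * (r - a2 x w)))) := by
    rw [calA2, one_div, ← mul_neg, ← intervalIntegral.integral_neg]
    congr 1
    refine intervalIntegral.integral_congr fun r hr => ?_
    rw [Set.uIcc_of_le h3.le] at hr
    rw [I2_eq hx hx4 w hr, div_eq_mul_inv, inv_Q2 hx hw hxw, cutDensity, div_eq_mul_inv, mul_inv]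
    ring
  have hr1 : ∀ p q : ℝ, (p : ℂ) ∈ D4 x → (w * p + gTilde x p) /
      (x ^ 2 * ((p - q) * (p - b1 x w) * (p - b2 x w))) =
      w * p * outerFactor x w p / (p - q) + cutSqrt (c1 x) (c2 x) p *
        (-x * cutSqrt (d1 x) (d2 x) p * outerFactor x w p) / (p - q) := by
    intro p q hp
    rw [gTilde_eq_gExt hx hx4 hp, gExt, outerFactor]
    simp only [div_eq_mul_inv, mul_inv]
    ring
  rw [e, i1, i2, hA2, calA1, res1, res2, hr1 _ _ (a1_mem_D4 hx hw hxw),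
    hr1 _ _ (a2_mem_D4 hx hw hxw)]
  ring

end Residues

/-! ### The generating function of squared binomial coefficients -/

section Series

/-- The squared binomial coefficient `((l + m).choose l) ^ 2` at `p = (l, m)`. -/
def chooseSq (p : ℕ × ℕ) : ℕ := ((p.1 + p.2).choose p.1) ^ 2

theorem sum_antidiagonal_chooseSq_le (n : ℕ) :
    ∑ p ∈ Finset.HasAntidiagonal.antidiagonal n, chooseSq p ≤ 4 ^ n := by
  have h : ∑ p ∈ Finset.HasAntidiagonal.antidiagonal n, chooseSq p =
      ∑ p ∈ Finset.HasAntidiagonal.antidiagonal n, (n.choose p.1) ^ 2 :=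
    Finset.sum_congr rfl fun p hp => by rw [chooseSq, Finset.HasAntidiagonal.mem_antidiagonal.1 hp]
  rw [h, Finset.Nat.sum_antidiagonal_eq_sum_range_succ_mk]
  calc ∑ k ∈ Finset.range n.succ, (n.choose k) ^ 2
      ≤ (∑ k ∈ Finset.range n.succ, n.choose k) ^ 2 :=
        Finset.sum_sq_le_sq_sum_of_nonneg fun i _ => Nat.zero_le _
    _ = 4 ^ n := by rw [Nat.sum_range_choose, ← pow_mul, mul_comm, pow_mul]; norm_num

theorem summable_chooseSq {x : ℝ} (hx : 0 < x) (hx4 : 4 * x < 1) :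
    Summable fun p : ℕ × ℕ => (chooseSq p : ℝ) * (x ^ p.1 * x ^ p.2) := by
  rw [← (Finset.HasAntidiagonal.sigmaAntidiagonalEquivProd (A := ℕ)).summable_iff]
  rw [summable_sigma_of_nonneg fun s => by simp only [Function.comp]; positivity]
  refine ⟨fun n => (hasSum_fintype _).summable, ?_⟩
  refine Summable.of_nonneg_of_le (fun n => tsum_nonneg fun _ => by
    simp only [Function.comp]; positivity) (fun n => ?_)
    (summable_geometric_of_lt_one (by linarith : 0 ≤ 4 * x) hx4)
  rw [tsum_fintype]
  simp only [Function.comp, Finset.HasAntidiagonal.sigmaAntidiagonalEquivProd_apply]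
  rw [Finset.sum_coe_sort (Finset.HasAntidiagonal.antidiagonal n)
    (fun p : ℕ × ℕ => (chooseSq p : ℝ) * (x ^ p.1 * x ^ p.2))]
  have h : ∑ p ∈ Finset.HasAntidiagonal.antidiagonal n, (chooseSq p : ℝ) * (x ^ p.1 * x ^ p.2) =
      ((∑ p ∈ Finset.HasAntidiagonal.antidiagonal n, chooseSq p : ℕ) : ℝ) * x ^ n := by
    push_cast
    rw [Finset.sum_mul]
    refine Finset.sum_congr rfl fun p hp => ?_
    rw [← pow_add, Finset.HasAntidiagonal.mem_antidiagonal.1 hp]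
  rw [h, mul_pow]
  gcongr
  exact_mod_cast sum_antidiagonal_chooseSq_le n

/-- The constant term of `((ζ + z⁻¹) (1 + z ζ⁻¹)) ^ n` as a Laurent polynomial in `ζ`, for
`z = exp (θ i)` and `ζ = exp (φ i)`. -/
theorem integral_cos_add_cos_pow (θ : ℝ) (n : ℕ) :
    ∫ φ in (0 : ℝ)..(2 * Real.pi), ((2 * Real.cos θ + 2 * Real.cos φ : ℝ) : ℂ) ^ n =
      2 * Real.pi * ∑ p ∈ Finset.HasAntidiagonal.antidiagonal n, (chooseSq p : ℂ) *
        (Complex.exp (θ * Complex.I) ^ p.1 * Complex.exp (-(θ * Complex.I)) ^ p.2) := by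
  set z := Complex.exp (θ * Complex.I) with hz
  set z' := Complex.exp (-(θ * Complex.I)) with hz'
  have hzz : z * z' = 1 := by rw [hz, hz', ← Complex.exp_add]; simp
  have h1 : ∀ φ : ℝ, ((2 * Real.cos θ + 2 * Real.cos φ : ℝ) : ℂ) ^ n =
      ∑ p ∈ Finset.HasAntidiagonal.antidiagonal n, ∑ s ∈ Finset.HasAntidiagonal.antidiagonal n,
        ((n.choose p.1 : ℂ) * n.choose s.1 * (z' ^ p.2 * z ^ s.1)) *
          Complex.exp (((p.1 : ℤ) - (s.1 : ℤ) : ℤ) * φ * Complex.I) := by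
    intro φ
    set ζ := Complex.exp (φ * Complex.I) with hζ
    set ζ' := Complex.exp (-(φ * Complex.I)) with hζ'
    have hζζ : ζ * ζ' = 1 := by rw [hζ, hζ', ← Complex.exp_add]; simp
    have e : ((2 * Real.cos θ + 2 * Real.cos φ : ℝ) : ℂ) = (ζ + z') * (z * ζ' + 1) := by
      push_cast
      rw [Complex.cos, Complex.cos, neg_mul, neg_mul, ← hz, ← hz', ← hζ, ← hζ']
      linear_combination -z * hζζ - ζ' * hzz
    rw [e, mul_pow, (Commute.all _ _).add_pow', (Commute.all _ _).add_pow', Finset.sum_mul_sum]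
    refine Finset.sum_congr rfl fun p _ => Finset.sum_congr rfl fun s _ => ?_
    have e2 : Complex.exp (((p.1 : ℤ) - (s.1 : ℤ) : ℤ) * φ * Complex.I) = ζ ^ p.1 * ζ' ^ s.1 := by
      rw [hζ, hζ', ← Complex.exp_nat_mul, ← Complex.exp_nat_mul, ← Complex.exp_add]
      congr 1; push_cast; ring
    rw [e2]
    simp only [nsmul_eq_mul, one_pow, mul_one, mul_pow]
    ring
  simp_rw [h1]
  have hc : ∀ (c : ℂ) (k : ℤ), Continuous fun φ : ℝ => c * Complex.exp (k * φ * Complex.I) :=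
    fun c k => by fun_prop
  rw [intervalIntegral.integral_finsetSum fun p _ => Continuous.intervalIntegrable
    (continuous_finsetSum _ fun s _ => hc _ _) _ _, Finset.mul_sum]
  refine Finset.sum_congr rfl fun p hp => ?_
  rw [intervalIntegral.integral_finsetSum fun s _ =>
    (hc _ _).intervalIntegrable _ _, Finset.sum_eq_single p]
  · rw [intervalIntegral.integral_const_mul, integral_exp_int_mul_I, sub_self, if_pos rfl,
      chooseSq, Finset.HasAntidiagonal.mem_antidiagonal.1 hp]
    push_cast; ring
  · intro s hs hsp
    rw [intervalIntegral.integral_const_mul, integral_exp_int_mul_I, if_neg, mul_zero]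
    intro h0
    refine hsp (Prod.ext ?_ ?_) <;>
    · have := Finset.HasAntidiagonal.mem_antidiagonal.1 hp
      have := Finset.HasAntidiagonal.mem_antidiagonal.1 hs
      lia
  · exact fun h => absurd hp h

theorem abs_cos_add_cos_le (θ φ : ℝ) : |2 * Real.cos θ + 2 * Real.cos φ| ≤ 4 := by
  have h1 := Real.neg_one_le_cos θ
  have h2 := Real.cos_le_one θ
  have h3 := Real.neg_one_le_cos φ
  have h4 := Real.cos_le_one φ
  exact abs_le.2 ⟨by linarith, by linarith⟩

variable {x w : ℝ}

theorem hasSum_integral_cos_add_cos_pow (hx : 0 < x) (hx4 : 4 * x < 1) (θ : ℝ) :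
    HasSum (fun n : ℕ => ∫ φ in (0 : ℝ)..(2 * Real.pi),
        ((x * (2 * Real.cos θ + 2 * Real.cos φ) : ℝ) : ℂ) ^ n)
      (∫ φ in (0 : ℝ)..(2 * Real.pi),
        (1 - ((x * (2 * Real.cos θ + 2 * Real.cos φ) : ℝ) : ℂ))⁻¹) := by
  have hb : ∀ φ : ℝ, ‖((x * (2 * Real.cos θ + 2 * Real.cos φ) : ℝ) : ℂ)‖ ≤ 4 * x := by
    intro φ
    rw [Complex.norm_real, Real.norm_eq_abs, abs_mul, abs_of_pos hx]
    nlinarith [abs_cos_add_cos_le θ φ]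
  have hg := summable_geometric_of_lt_one (by linarith : 0 ≤ 4 * x) hx4
  refine intervalIntegral.hasSum_integral_of_dominated_convergence
    (fun n _ => (4 * x) ^ n) (fun n => ?_) (fun n => ?_) ?_ ?_ ?_
  · exact Continuous.aestronglyMeasurable (by fun_prop)
  · refine Eventually.of_forall fun φ _ => ?_
    rw [norm_pow]
    exact pow_le_pow_left₀ (norm_nonneg _) (hb φ) n
  · exact Eventually.of_forall fun φ _ => hg
  · exact intervalIntegrable_const
  · exact Eventually.of_forall fun φ _ =>
      hasSum_geometric_of_norm_lt_one ((hb φ).trans_lt hx4)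

theorem integral_inv_one_sub_cos (hx : 0 < x) (hx4 : 4 * x < 1) (θ : ℝ) :
    ∫ φ in (0 : ℝ)..(2 * Real.pi), (1 - ((x * (2 * Real.cos θ + 2 * Real.cos φ) : ℝ) : ℂ))⁻¹ =
      2 * Real.pi * ((radial x (Real.cos θ) : ℝ) : ℂ)⁻¹ := by
  -- With `q` a root of `x q² - (1 - 2x cos θ) q + x` the integrand is a Poisson kernel.
  have ht : 2 * x < 1 - 2 * x * Real.cos θ := by nlinarith [Real.cos_le_one θ]
  set t := 1 - 2 * x * Real.cos θ with htdef
  set q := smallRoot x t with hq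
  have hq0 : 0 < q := smallRoot_pos hx ht
  have hq1 : q < 1 := smallRoot_lt_one hx ht
  have hsum : x * (q + q⁻¹) = t := smallRoot_add_inv hx ht
  have hrad : radial x (Real.cos θ) = x * (q⁻¹ - q) := by
    rw [hq, ← largeRoot_eq hx ht, smallRoot, radial]
    field_simp
    ring
  have hqn : ‖(q : ℂ)‖ < 1 := by rwa [Complex.norm_real, Real.norm_eq_abs, abs_of_pos hq0]
  have hqc : (q : ℂ) ≠ 0 := by exact_mod_cast hq0.ne'
  have hxc : (x : ℂ) ≠ 0 := by exact_mod_cast hx.ne'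
  have h1 : ∀ φ : ℝ, (1 - ((x * (2 * Real.cos θ + 2 * Real.cos φ) : ℝ) : ℂ))⁻¹ =
      (q / x : ℂ) * (1 - 2 * q * Real.cos φ + (q : ℂ) ^ 2)⁻¹ := by
    intro φ
    have h2 : (1 - x * (2 * Real.cos θ + 2 * Real.cos φ) : ℝ) =
        x / q * (1 - 2 * q * Real.cos φ + q ^ 2) := by
      have : 1 - x * (2 * Real.cos θ + 2 * Real.cos φ) = t - 2 * x * Real.cos φ := by
        rw [htdef]; ring
      rw [this, ← hsum]; field_simp; ring
    have h3 : 1 - ((x * (2 * Real.cos θ + 2 * Real.cos φ) : ℝ) : ℂ) =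
        x / q * (1 - 2 * q * Real.cos φ + (q : ℂ) ^ 2) := by exact_mod_cast h2
    rw [h3, mul_inv, inv_div]
  simp_rw [h1]
  rw [intervalIntegral.integral_const_mul, integral_inv_poisson hqn, hrad]
  push_cast
  have h4 : (1 - (q : ℂ) ^ 2) ≠ 0 := by
    have : 1 - q ^ 2 ≠ 0 := by nlinarith
    exact_mod_cast this
  have h5 : ((q : ℂ)⁻¹ - q) = (1 - (q : ℂ) ^ 2) / q := by field_simp
  rw [h5]
  field_simp

/-- The term of the bivariate generating function at `u = x exp (θ i)`, `v = x exp (-θ i)`. -/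
noncomputable def circleTerm (x θ : ℝ) (p : ℕ × ℕ) : ℂ :=
  (chooseSq p : ℂ) * ((x * Complex.exp (θ * Complex.I)) ^ p.1 *
    (x * Complex.exp (-(θ * Complex.I))) ^ p.2)

theorem norm_exp_neg_mul_I (θ : ℝ) : ‖Complex.exp (-(θ * Complex.I))‖ = 1 := by
  rw [← neg_mul, ← Complex.ofReal_neg, Complex.norm_exp_ofReal_mul_I]

theorem norm_circleTerm (hx : 0 < x) (θ : ℝ) (p : ℕ × ℕ) :
    ‖circleTerm x θ p‖ = (chooseSq p : ℝ) * (x ^ p.1 * x ^ p.2) := by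
  simp [circleTerm, Complex.norm_exp_ofReal_mul_I, norm_exp_neg_mul_I, abs_of_pos hx]

/-- The squared binomial coefficients have the generating function
`1 / √((1 - u - v)² - 4uv)`, here on the torus `|u| = |v| = x` with `u v = x²`. -/
theorem hasSum_circleTerm (hx : 0 < x) (hx4 : 4 * x < 1) (θ : ℝ) :
    HasSum (circleTerm x θ) ((radial x (Real.cos θ) : ℝ) : ℂ)⁻¹ := by
  have hs : Summable (circleTerm x θ) := by
    refine Summable.of_norm ?_
    simp_rw [norm_circleTerm hx]
    exact summable_chooseSq hx hx4
  rw [← (Finset.HasAntidiagonal.sigmaAntidiagonalEquivProd (A := ℕ)).hasSum_iff]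
  refine HasSum.sigma_of_hasSum ?_ (fun n => hasSum_fintype _)
    ((Finset.HasAntidiagonal.sigmaAntidiagonalEquivProd (A := ℕ)).summable_iff.2 hs)
  have hπ : (2 * Real.pi : ℂ) ≠ 0 := by
    have := Real.two_pi_pos.ne'
    exact_mod_cast this
  have h := (hasSum_integral_cos_add_cos_pow hx hx4 θ).mul_left (2 * Real.pi : ℂ)⁻¹
  rw [integral_inv_one_sub_cos hx hx4, inv_mul_cancel_left₀ hπ] at h
  refine h.congr_fun fun n => ?_
  simp only [Function.comp, Finset.HasAntidiagonal.sigmaAntidiagonalEquivProd_apply]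
  rw [Finset.sum_coe_sort (Finset.HasAntidiagonal.antidiagonal n) (circleTerm x θ)]
  have h2 : ∀ φ : ℝ, ((x * (2 * Real.cos θ + 2 * Real.cos φ) : ℝ) : ℂ) ^ n =
      (x : ℂ) ^ n * ((2 * Real.cos θ + 2 * Real.cos φ : ℝ) : ℂ) ^ n := fun φ => by
    rw [Complex.ofReal_mul, mul_pow]
  simp_rw [h2]
  rw [intervalIntegral.integral_const_mul, integral_cos_add_cos_pow, mul_left_comm,
    inv_mul_cancel_left₀ hπ, Finset.mul_sum]
  refine Finset.sum_congr rfl fun p hp => ?_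
  rw [circleTerm, ← Finset.HasAntidiagonal.mem_antidiagonal.1 hp, mul_pow, mul_pow, pow_add]
  ring

/-! ### Powers of the generating function -/

/-- Powers of an absolutely convergent series, expanded over tuples of indices. -/
theorem hasSum_prod_fin {ι : Type*} {f : ι → ℂ} {F : ℂ} (hf : HasSum f F)
    (hn : Summable fun i => ‖f i‖) (k : ℕ) :
    HasSum (fun p : Fin k → ι => ∏ i, f (p i)) (F ^ k) ∧
      Summable fun p : Fin k → ι => ‖∏ i, f (p i)‖ := by
  induction k with
  | zero =>
    constructor
    · simp
    · exact (hasSum_unique _).summable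
  | succ k ih =>
    obtain ⟨h1, h2⟩ := ih
    have hm : Summable fun p : ι × (Fin k → ι) => ‖f p.1 * ∏ i, f (p.2 i)‖ :=
      Summable.mul_norm (f := f) (g := fun p : Fin k → ι => ∏ i, f (p i)) hn h2
    have hs : Summable fun p : ι × (Fin k → ι) => f p.1 * ∏ i, f (p.2 i) := hm.of_norm
    have e : (fun p : ι × (Fin k → ι) => f p.1 * ∏ i, f (p.2 i)) =
        (fun p : Fin (k + 1) → ι => ∏ i, f (p i)) ∘ Fin.consEquiv (fun _ => ι) := by
      ext p; simp [Fin.prod_univ_succ, Fin.consEquiv]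
    constructor
    · rw [← (Fin.consEquiv fun _ => ι).hasSum_iff, ← e, pow_succ']
      exact HasSum.mul (f := f) (g := fun p : Fin k → ι => ∏ i, f (p i)) hf h1 hs
    · rw [← (Fin.consEquiv fun _ => ι).summable_iff]
      refine hm.congr fun p => ?_
      exact congrArg norm (congrFun e p)

/-- Tuples of pairs, sorted by the totals of the two components. -/
def tupleEquiv (k : ℕ) :
    (Σ s : ℕ × ℕ, (Finset.Nat.antidiagonalTuple k s.1 ×ˢ Finset.Nat.antidiagonalTuple k s.2 :
      Finset ((Fin k → ℕ) × (Fin k → ℕ)))) ≃ (Fin k → ℕ × ℕ) where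
  toFun s i := (s.2.1.1 i, s.2.1.2 i)
  invFun p := ⟨(∑ i, (p i).1, ∑ i, (p i).2), (fun i => (p i).1, fun i => (p i).2), by
    simp [Finset.Nat.mem_antidiagonalTuple]⟩
  left_inv := by
    rintro ⟨⟨L, M⟩, ⟨l, m⟩, h⟩
    simp only [Finset.mem_product, Finset.Nat.mem_antidiagonalTuple] at h
    exact Sigma.subtype_ext (Prod.ext h.1 h.2) rfl
  right_inv _ := rfl

/-- The off-diagonal extension of `A`: the totals of the two tuples are `L` and `M`, and
`tupleSum j N N = A N j`. -/
def tupleSum (j L M : ℕ) : ℕ :=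
  ∑ l ∈ Finset.Nat.antidiagonalTuple (j + 1) L, ∑ m ∈ Finset.Nat.antidiagonalTuple (j + 1) M,
    ∏ r : Fin (j + 1), ((l r + m r).choose (l r)) ^ 2

/-- The coefficient of the `(j + 1)`-st power of the generating function. -/
noncomputable def powerTerm (x θ : ℝ) (j : ℕ) (s : ℕ × ℕ) : ℂ :=
  (tupleSum j s.1 s.2 : ℂ) * ((x * Complex.exp (θ * Complex.I)) ^ s.1 *
    (x * Complex.exp (-(θ * Complex.I))) ^ s.2)

theorem hasSum_powerTerm (hx : 0 < x) (hx4 : 4 * x < 1) (θ : ℝ) (j : ℕ) :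
    HasSum (powerTerm x θ j) (((radial x (Real.cos θ) : ℝ) : ℂ)⁻¹ ^ (j + 1)) := by
  have hn : Summable fun p => ‖circleTerm x θ p‖ := by
    simp_rw [norm_circleTerm hx]
    exact summable_chooseSq hx hx4
  have h := (hasSum_prod_fin (hasSum_circleTerm hx hx4 θ) hn (j + 1)).1
  rw [← (tupleEquiv (j + 1)).hasSum_iff] at h
  refine h.sigma fun s => ?_
  have h2 := hasSum_fintype fun c : (Finset.Nat.antidiagonalTuple (j + 1) s.1 ×ˢ
    Finset.Nat.antidiagonalTuple (j + 1) s.2 : Finset ((Fin (j + 1) → ℕ) × (Fin (j + 1) → ℕ))) =>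
    ((fun p : Fin (j + 1) → ℕ × ℕ => ∏ i, circleTerm x θ (p i)) ∘ tupleEquiv (j + 1)) ⟨s, c⟩
  convert h2 using 1
  simp only [Function.comp, tupleEquiv, Equiv.coe_fn_mk]
  rw [Finset.sum_coe_sort (Finset.Nat.antidiagonalTuple (j + 1) s.1 ×ˢ
    Finset.Nat.antidiagonalTuple (j + 1) s.2)
    (fun c => ∏ i, circleTerm x θ (c.1 i, c.2 i)), Finset.sum_product, powerTerm, tupleSum]
  push_cast
  rw [Finset.sum_mul]
  refine Finset.sum_congr rfl fun l hl => ?_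
  rw [Finset.sum_mul]
  refine Finset.sum_congr rfl fun m hm => ?_
  rw [Finset.Nat.mem_antidiagonalTuple] at hl hm
  simp only [circleTerm, chooseSq, Finset.prod_mul_distrib, Finset.prod_pow_eq_pow_sum, hl, hm]
  push_cast
  rfl

theorem norm_powerTerm (hx : 0 < x) (θ : ℝ) (j : ℕ) (s : ℕ × ℕ) :
    ‖powerTerm x θ j s‖ = (tupleSum j s.1 s.2 : ℝ) * (x ^ s.1 * x ^ s.2) := by
  simp [powerTerm, Complex.norm_exp_ofReal_mul_I, norm_exp_neg_mul_I, abs_of_pos hx]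

theorem hasSum_tupleSum (hx : 0 < x) (hx4 : 4 * x < 1) (j : ℕ) :
    HasSum (fun s : ℕ × ℕ => (tupleSum j s.1 s.2 : ℝ) * (x ^ s.1 * x ^ s.2))
      ((radial x 1)⁻¹ ^ (j + 1)) := by
  have h := hasSum_powerTerm hx hx4 0 j
  rw [Real.cos_zero] at h
  rw [← Complex.hasSum_ofReal]
  push_cast
  refine h.congr_fun fun s => ?_
  simp [powerTerm]

/-! ### The series for `α` as an integral over the circle -/

/-- The term of the triple series whose diagonal part in `(L, M)` is the series for `α`. -/
noncomputable def fullTerm (x w θ : ℝ) (t : ℕ × (ℕ × ℕ)) : ℂ :=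
  (w : ℂ) ^ t.1 * powerTerm x θ t.1 t.2

/-- The common modulus of `fullTerm x w θ` for all `θ`. -/
noncomputable def fullBound (x w : ℝ) (t : ℕ × (ℕ × ℕ)) : ℝ :=
  w ^ t.1 * ((tupleSum t.1 t.2.1 t.2.2 : ℝ) * (x ^ t.2.1 * x ^ t.2.2))

theorem norm_fullTerm (hx : 0 < x) (hw : 0 < w) (θ : ℝ) (t : ℕ × (ℕ × ℕ)) :
    ‖fullTerm x w θ t‖ = fullBound x w t := by
  rw [fullTerm, norm_mul, norm_powerTerm hx, fullBound, norm_pow, Complex.norm_real,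
    Real.norm_eq_abs, abs_of_pos hw]

theorem summable_fullBound (hx : 0 < x) (hw : 0 < w) (hxw : 4 * x + w ^ 2 < 1) :
    Summable (fullBound x w) := by
  have hx4 : 4 * x < 1 := by nlinarith
  have hlt := lt_radial hx hxw le_rfl
  have hr : 0 < radial x 1 := hw.trans hlt
  have hs := fun j => (hasSum_tupleSum hx hx4 j).mul_left (w ^ j)
  rw [summable_prod_of_nonneg fun t => by simp only [Pi.zero_apply, fullBound]; positivity]
  refine ⟨fun j => (hs j).summable, ?_⟩
  have h1 : ∀ j, ∑' s, fullBound x w (j, s) = (radial x 1)⁻¹ * (w / radial x 1) ^ j := by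
    intro j
    rw [show ∑' s, fullBound x w (j, s) = _ from (hs j).tsum_eq, div_pow, pow_succ, inv_pow]
    field_simp
  simp_rw [h1]
  exact (summable_geometric_of_lt_one (by positivity) ((div_lt_one hr).2 hlt)).mul_left _

/-- Summing first over `(L, M)` and then over `j` gives the geometric series of `w / S`, where
`S = radial x (cos θ)`. -/
theorem hasSum_fullTerm (hx : 0 < x) (hw : 0 < w) (hxw : 4 * x + w ^ 2 < 1) (θ : ℝ) :
    HasSum (fullTerm x w θ) (((radial x (Real.cos θ) - w : ℝ) : ℂ)⁻¹) := by
  have hx4 : 4 * x < 1 := by nlinarith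
  have hlt := lt_radial hx hxw (Real.cos_le_one θ)
  have hr : 0 < radial x (Real.cos θ) := hw.trans hlt
  set S := radial x (Real.cos θ) with hS
  have hsum : Summable (fullTerm x w θ) := by
    refine Summable.of_norm ?_
    simp_rw [norm_fullTerm hx hw]
    exact summable_fullBound hx hw hxw
  have h1 := hsum.hasSum.prod_fiberwise fun j =>
    show HasSum (fun s => fullTerm x w θ (j, s)) ((w : ℂ) ^ j * (S : ℂ)⁻¹ ^ (j + 1)) from
      (hasSum_powerTerm hx hx4 θ j).mul_left ((w : ℂ) ^ j)
  have hSc : (S : ℂ) ≠ 0 := by exact_mod_cast hr.ne'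
  have hd : (S : ℂ) - w ≠ 0 := by
    have : S - w ≠ 0 := by linarith
    exact_mod_cast this
  have h2 : HasSum (fun j : ℕ => (S : ℂ)⁻¹ * ((w / S : ℝ) : ℂ) ^ j)
      ((S : ℂ)⁻¹ * (1 - ((w / S : ℝ) : ℂ))⁻¹) := by
    have hlt1 : ‖((w / S : ℝ) : ℂ)‖ < 1 := by
      rw [Complex.norm_real, Real.norm_eq_abs, abs_of_pos (div_pos hw hr)]
      exact (div_lt_one hr).2 hlt
    exact (hasSum_geometric_of_norm_lt_one hlt1).mul_left _
  have h3 : ∑' t, fullTerm x w θ t = ((S - w : ℝ) : ℂ)⁻¹ := by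
    refine h1.unique ?_
    convert h2 using 1
    · ext j
      push_cast
      rw [pow_succ, div_pow, inv_pow]
      field_simp
    · push_cast
      rw [← mul_inv]
      congr 1
      field_simp
  rw [← h3]
  exact hsum.hasSum

theorem integral_fullTerm (x w : ℝ) (t : ℕ × (ℕ × ℕ)) :
    ∫ θ in (0 : ℝ)..(2 * Real.pi), fullTerm x w θ t =
      if t.2.1 = t.2.2 then 2 * Real.pi * (fullBound x w t : ℂ) else 0 := by
  have h : ∀ θ : ℝ, fullTerm x w θ t = (fullBound x w t : ℂ) *
      Complex.exp (((t.2.1 : ℤ) - (t.2.2 : ℤ) : ℤ) * θ * Complex.I) := by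
    intro θ
    have e : Complex.exp (((t.2.1 : ℤ) - (t.2.2 : ℤ) : ℤ) * θ * Complex.I) =
        Complex.exp (θ * Complex.I) ^ t.2.1 * Complex.exp (-(θ * Complex.I)) ^ t.2.2 := by
      rw [← Complex.exp_nat_mul, ← Complex.exp_nat_mul, ← Complex.exp_add]
      congr 1; push_cast; ring
    rw [e, fullTerm, powerTerm, fullBound]
    push_cast
    ring
  simp_rw [h]
  rw [intervalIntegral.integral_const_mul, integral_exp_int_mul_I]
  by_cases ht : t.2.1 = t.2.2
  · simp [ht]; ring
  · rw [if_neg ht, if_neg (by omega), mul_zero]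

/-- Integration over the circle picks out the diagonal of the triple series. -/
theorem hasSum_alphaTerm (hx : 0 < x) (hw : 0 < w) (hxw : 4 * x + w ^ 2 < 1) :
    HasSum (fun p => (alphaTerm w (x ^ 2) p : ℂ)) ((2 * Real.pi : ℂ)⁻¹ *
      ∫ θ in (0 : ℝ)..(2 * Real.pi), ((radial x (Real.cos θ) - w : ℝ) : ℂ)⁻¹) := by
  have hπ : (2 * Real.pi : ℂ) ≠ 0 := by
    have := Real.two_pi_pos.ne'
    exact_mod_cast this
  have h : HasSum (fun t => ∫ θ in (0 : ℝ)..(2 * Real.pi), fullTerm x w θ t)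
      (∫ θ in (0 : ℝ)..(2 * Real.pi), ((radial x (Real.cos θ) - w : ℝ) : ℂ)⁻¹) := by
    refine intervalIntegral.hasSum_integral_of_dominated_convergence
      (fun t _ => fullBound x w t) (fun t => ?_) (fun t => ?_) ?_ ?_ ?_
    · refine Continuous.aestronglyMeasurable ?_
      unfold fullTerm powerTerm
      fun_prop
    · exact Eventually.of_forall fun θ _ => (norm_fullTerm hx hw θ t).le
    · exact Eventually.of_forall fun θ _ => summable_fullBound hx hw hxw
    · exact intervalIntegrable_const
    · exact Eventually.of_forall fun θ _ => hasSum_fullTerm hx hw hxw θ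
  simp_rw [integral_fullTerm] at h
  have hinj : Function.Injective fun p : ℕ × ℕ => (p.1, (p.2, p.2)) := by
    rintro ⟨a, b⟩ ⟨c, d⟩ h
    simp only [Prod.mk.injEq] at h
    exact Prod.ext h.1 h.2.1
  rw [← hinj.hasSum_iff] at h
  · refine (h.mul_left (2 * Real.pi : ℂ)⁻¹).congr_fun fun p => ?_
    simp only [Function.comp, if_true]
    rw [inv_mul_cancel_left₀ hπ, fullBound, alphaTerm, A]
    simp only [tupleSum]
    push_cast
    ring
  · rintro ⟨j, L, M⟩ ht
    refine if_neg fun hLM => ht ⟨(j, L), ?_⟩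
    simp only at hLM
    rw [hLM]

theorem summable_alphaTerm (hx : 0 < x) (hw : 0 < w) (hxw : 4 * x + w ^ 2 < 1) :
    Summable (alphaTerm w (x ^ 2)) :=
  Complex.summable_ofReal.1 (hasSum_alphaTerm hx hw hxw).summable

theorem alpha_eq_circleIntegral (hx : 0 < x) (hw : 0 < w) (hxw : 4 * x + w ^ 2 < 1) :
    (alpha w (x ^ 2) : ℂ) = (2 * (Real.pi : ℂ) * Complex.I)⁻¹ *
      ∮ ξ in C(0, 1), 1 / (Complex.sqrt ((1 - x * ξ - x / ξ) ^ 2 - 4 * x ^ 2) - w) * (1 / ξ) := by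
  have hx4 : 4 * x < 1 := by nlinarith
  rw [alpha, Complex.ofReal_tsum, (hasSum_alphaTerm hx hw hxw).tsum_eq, circleIntegral]
  have h : ∀ θ : ℝ, deriv (circleMap 0 1) θ • (1 / (Complex.sqrt ((1 - x * circleMap 0 1 θ -
      x / circleMap 0 1 θ) ^ 2 - 4 * x ^ 2) - w) * (1 / circleMap 0 1 θ)) =
      Complex.I * ((radial x (Real.cos θ) - w : ℝ) : ℂ)⁻¹ := by
    intro θ
    have hn : ‖circleMap 0 1 θ‖ = 1 := by simp
    have hre : (circleMap 0 1 θ).re = Real.cos θ := by simp [circleMap, Complex.exp_ofReal_mul_I_re]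
    have h0 : circleMap 0 1 θ ≠ 0 := fun h => by simp [h] at hn
    rw [sqrt_eq_radial hx hx4 hn, hre, deriv_circleMap, smul_eq_mul]
    push_cast
    field_simp
  rw [intervalIntegral.integral_congr fun θ _ => h θ, intervalIntegral.integral_const_mul,
    mul_inv (2 * (Real.pi : ℂ)), mul_assoc, inv_mul_cancel_left₀ Complex.I_ne_zero]

end Series

theorem mainTheorem2 (x w : ℝ) (hx : 0 < x) (hw : 0 < w) (hxw : 4 * x + w ^ 2 < 1) :
    -- the identity, with the series defining `α` convergent
    Summable (alphaTerm w (x ^ 2)) ∧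
    (alpha w (x ^ 2) : ℂ) = calA1 x w + calA2 x w ∧
    -- the positions of the roots and of the cut
    (0 < a1 x w ∧ a1 x w < c1 x ∧ c1 x < c2 x ∧ c2 x < a2 x w ∧ a2 x w < 1) ∧
    -- `gTilde x` is an analytic continuation of `g x`; its boundary values on the cut exist
    AnalyticOnNhd ℂ (gTilde x) (D4 x) ∧
    (∀ r ∈ Set.Icc (c1 x) (c2 x),
      Tendsto (fun ε : ℝ => gTilde x ((r : ℂ) + Complex.I * ε)) (𝓝[>] 0) (𝓝 (gPlus x r)) ∧
      Tendsto (fun ε : ℝ => gTilde x ((r : ℂ) - Complex.I * ε)) (𝓝[>] 0) (𝓝 (gMinus x r))) ∧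
    IntervalIntegrable (I2 x w) MeasureTheory.volume (c1 x) (c2 x) ∧
    -- the two terms of `calA1` are the residues of the integrand at `a₁` and `a₂`
    Tendsto (fun ξ : ℂ => (ξ - a1 x w) * integrand x w ξ) (𝓝[≠] (a1 x w : ℂ)) (𝓝 (res1 x w)) ∧
    Tendsto (fun ξ : ℂ => (ξ - a2 x w) * integrand x w ξ) (𝓝[≠] (a2 x w : ℂ)) (𝓝 (res2 x w)) ∧
    -- the circle integral for `α`
    (alpha w (x ^ 2) : ℂ) = (2 * (Real.pi : ℂ) * Complex.I)⁻¹ *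
      ∮ ξ in C(0, 1), 1 / (Complex.sqrt ((1 - x * ξ - x / ξ) ^ 2 - 4 * x ^ 2) - w) * (1 / ξ) := by
  have hx4 : 4 * x < 1 := by nlinarith
  have hcirc := alpha_eq_circleIntegral hx hw hxw
  refine ⟨summable_alphaTerm hx hw hxw, ?_, root_order hx hw hxw, analyticOnNhd_gTilde hx hx4,
    fun r hr => ⟨?_, ?_⟩, intervalIntegrable_I2 hx hw hxw, tendsto_res1 hx hw hxw,
    tendsto_res2 hx hw hxw, hcirc⟩
  · rw [hcirc, ← circleIntegral.integral_congr zero_le_one fun ξ hξ =>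
        integrand_eq hx hw hxw (mem_sphere_zero_iff_norm.1 hξ),
      circleIntegral_integrand hx hw hxw, inv_mul_cancel_left₀ Complex.two_pi_I_ne_zero]
  · rw [gPlus_eq hx hx4 hr]; exact tendsto_gTilde_add hx hx4 hr
  · rw [gMinus_eq hx hx4 hr]; exact tendsto_gTilde_sub hx hx4 hr
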